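/- Words are nonempty words over the alphabet $\Sigma=\{l,r\}$ (left and right brace), viewed as finite linearly ordered structures over the vocabulary $\{<,P_l,P_r\}$. The size $\mathrm{sz}(\varphi)$ of a first-order formula is $1$ for atomic formulas ($x=y$, $x<y$, $P_l(x)$, $P_r(x)$), $\mathrm{sz}(\psi)+\mathrm{sz}(\theta)+1$ for $\psi\land\theta$ and $\psi\lor\theta$, and $\mathrm{sz}(\psi)+1$ for $\neg\psi$, $\exists x\,\psi$ and $\forall x\,\psi$; $\mathrm{FO}[n]$ is the set of first-order sentences of size at most $n$. A sentence defines the word $w$ if $w$ is the only nonempty word that satisfies it. $\mathrm{DN}(\mathrm{FO}[n])$ is the maximal length of a word that is defined by some sentence in $\mathrm{FO}[n]$. $\mathrm{H}(\mathrm{FO}[n])=\max\{\nu(\varphi)\mid\varphi\in\mathrm{FO}[n]\}$, where $\nu(\varphi)$ is the maximal length of a word satisfying $\varphi$, and $\nu(\varphi)=0$ if there is no such maximum (no models, or arbitrarily long models). Let $\mathrm{tower}(0)=1$, $\mathrm{tower}(m+1)=2^{\mathrm{tower}(m)}$, and $\mathrm{twr}(x)=\mathrm{tower}(\lceil x\rceil)$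 for real $x\ge 0$. Let $V_0=\emptyset$ and $V_{i+1}=\mathcal P(V_i)$. Order the hereditarily finite sets by $x\prec y$ iff $x \neq y$ and the $\prec$-greatest element of the symmetric difference of $x$ and $y$ belongs to $y$. An ordered, repetition-free brace encoding of a set $x=\{x_0\prec\dots\prec x_{k-1}\}$ is a word $l\,w_0w_1\cdots w_{k-1}\,r$, where each $w_j$ is an ordered, repetition-free brace encoding of $x_j$. **Theorem.** 1. There is a positive integer $c$ such that, for infinitely many $n\in\mathbb N$, the maximum $\mathrm{DN}(\mathrm{FO}[n])$ exists and $$\mathrm{DN}(\mathrm{FO}[n])\ \ge\ \mathrm{twr}\big(\sqrt[5]{n/c}\big).$$ 2. There is a positive integer $c$ such that, for infinitely many $n\in\mathbb N$, the maximum $\mathrm{H}(\mathrm{FO}[n])$ exists and $$\mathrm{H}(\mathrm{FO}[n])\ \ge\ \mathrm{twr}\big(\sqrt[5]{n/c}\big).$$ 3. There are a constant $c$ and first-order sentences $\psi_i$, $i\in\mathbb N$, with $\mathrm{sz}(\psi_i)\le c\,i^5$ for all $i\ge 1$, such that for every $i\in\mathbb N$ the set $V_i$ has exactly one ordered, repetition-free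 brace encoding $w_i$, the sentence $\psi_i$ defines the word $w_i$, and $|w_{i+1}|\ge\mathrm{tower}(i)$. -/

import Mathlib

/-- The two-letter alphabet: a left brace and a right brace. -/
inductive Brace : Type
  | l
  | r

/-- Words over the two-letter alphabet. Only nonempty words are used as models. -/
abbrev Word : Type := List Brace

/-- First-order formulas of the vocabulary `{<, P_l, P_r}` (with equality) whose free variables
are among `k` given ones, with exactly the primitive connectives on which formula size is defined.
The variable bound by a quantifier in front of a formula with `k + 1` free variables is the last
one, as in Mathlib's `FirstOrder.Language.BoundedFormula`. (Mathlib's formulas have `→`, `⊥`, `∀` as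
primitives, so the size below would not be a function on them.) -/
inductive FOFormula : ℕ → Type
  | eq {k : ℕ} (x y : Fin k) : FOFormula k
  | lt {k : ℕ} (x y : Fin k) : FOFormula k
  | letter {k : ℕ} (a : Brace) (x : Fin k) : FOFormula k
  | neg {k : ℕ} (φ : FOFormula k) : FOFormula k
  | and {k : ℕ} (φ ψ : FOFormula k) : FOFormula k
  | or {k : ℕ} (φ ψ : FOFormula k) : FOFormula k
  | ex {k : ℕ} (φ : FOFormula (k + 1)) : FOFormula k
  | all {k : ℕ} (φ : FOFormula (k + 1)) : FOFormula k

/-- Sentences are the formulas without free variables. -/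
abbrev FOSentence : Type := FOFormula 0

namespace FOFormula

/-- The size of a formula. -/
def size : {k : ℕ} → FOFormula k → ℕ
  | _, eq _ _ => 1
  | _, lt _ _ => 1
  | _, letter _ _ => 1
  | _, neg φ => φ.size + 1
  | _, and φ ψ => φ.size + ψ.size + 1
  | _, or φ ψ => φ.size + ψ.size + 1
  | _, ex φ => φ.size + 1
  | _, all φ => φ.size + 1

/-- Satisfaction in the word model of `w`: the domain is the set of positions of `w` with its
natural order, and `P_a` holds at the positions that carry the letter `a`. -/
def Sat (w : Word) : {k : ℕ} → FOFormula k → (Fin k → Fin w.length) → Prop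
  | _, eq x y, s => s x = s y
  | _, lt x y, s => s x < s y
  | _, letter a x, s => w.get (s x) = a
  | _, neg φ, s => ¬ Sat w φ s
  | _, and φ ψ, s => Sat w φ s ∧ Sat w ψ s
  | _, or φ ψ, s => Sat w φ s ∨ Sat w ψ s
  | _, ex φ, s => ∃ p : Fin w.length, Sat w φ (Fin.snoc (α := fun _ => Fin w.length) s p)
  | _, all φ, s => ∀ p : Fin w.length, Sat w φ (Fin.snoc (α := fun _ => Fin w.length) s p)

end FOFormula

/-- `w ⊨ φ` for a sentence `φ`. -/
def Models (w : Word) (φ : FOSentence) : Prop :=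
  φ.Sat w Fin.elim0

/-- The sentence `φ` defines the nonempty word `w`: among all nonempty words, `w` is
the only one that satisfies `φ`. -/
def Defines (φ : FOSentence) (w : Word) : Prop :=
  w ≠ [] ∧ Models w φ ∧ ∀ v : Word, v ≠ [] → v ≠ w → ¬ Models v φ

/-- The fragment `FO[n]`: the sentences of size at most `n`. -/
def FOsz (n : ℕ) : Set FOSentence :=
  {φ | φ.size ≤ n}

/-- The set of words definable in the fragment `L`. -/
def DefinableWords (L : Set FOSentence) : Set Word :=
  {w | ∃ φ ∈ L, Defines φ w}

/-- The lengths of the words definable in the fragment `L`. -/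
def definableLengths (L : Set FOSentence) : Set ℕ :=
  {m | ∃ w ∈ DefinableWords L, w.length = m}

/-- The definability number of `L`: the maximum of `definableLengths L` (when it exists). -/
noncomputable def definabilityNumber (L : Set FOSentence) : ℕ :=
  sSup (definableLengths L)

/-- The lengths of the (nonempty) words that satisfy `φ`. -/
def modelLengths (φ : FOSentence) : Set ℕ :=
  {m | ∃ w : Word, w ≠ [] ∧ Models w φ ∧ w.length = m}

open Classical in
/-- The maximal length of a model of `φ`; it is `0` if there is no maximum, that is, if `φ` has no
model or has arbitrarily long models. -/
noncomputable def maxModelLength (φ : FOSentence) : ℕ :=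
  if BddAbove (modelLengths φ) then sSup (modelLengths φ) else 0

/-- The values of `maxModelLength` on the fragment `L`. -/
def maxModelLengths (L : Set FOSentence) : Set ℕ :=
  {m | ∃ φ ∈ L, maxModelLength φ = m}

/-- The Hanf number of `L`: the maximum of `maxModelLengths L` (when it exists). -/
noncomputable def hanfNumber (L : Set FOSentence) : ℕ :=
  sSup (maxModelLengths L)

/-- The exponential tower: `tower 0 = 1`, `tower (n + 1) = 2 ^ tower n`. -/
def tower : ℕ → ℕ
  | 0 => 1
  | n + 1 => 2 ^ tower n

/-- The extension of `tower` to nonnegative reals, by rounding the argument up. -/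
noncomputable def twr (x : ℝ) : ℕ :=
  tower ⌈x⌉₊

/-- The order on (hereditarily finite) sets by the greatest element of the symmetric
difference: `x ≺ y` if some `z ∈ y \ x` is greater than every element of `x \ y`. The recursion
goes down the membership relation. -/
inductive SetPrec : ZFSet.{0} → ZFSet.{0} → Prop
  | intro (x y z : ZFSet.{0}) (hzy : z ∈ y) (hzx : z ∉ x)
      (h : ∀ a : ZFSet.{0}, a ∈ x → a ∉ y → SetPrec a z) : SetPrec x y

/-- `OrderedEncoding w x`: the word `w` is an ordered, repetition-free brace encoding of the set
`x`, that is, `w = l w₀ ⋯ wₖ₋₁ r` where `x = {x₀, …, xₖ₋₁}`, `x₀ ≺ ⋯ ≺ xₖ₋₁`, and each `wⱼ` is in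
turn an ordered, repetition-free brace encoding of `xⱼ`. -/
inductive OrderedEncoding : Word → ZFSet.{0} → Prop
  | intro (k : ℕ) (ws : Fin k → Word) (xs : Fin k → ZFSet.{0}) (x : ZFSet.{0})
      (helem : ∀ z : ZFSet.{0}, z ∈ x ↔ ∃ j, xs j = z)
      (hord : ∀ i j : Fin k, i < j → SetPrec (xs i) (xs j))
      (henc : ∀ j, OrderedEncoding (ws j) (xs j)) :
      OrderedEncoding (Brace.l :: ((List.ofFn ws).flatten ++ [Brace.r])) x

/-! The set $V_{i+1}$ has $\mathrm{tower}(i)$ elements, each contributing to its encoding, so it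
suffices to define the ordered encoding of $V_i$ by a sentence of size polynomial in $i$.

First-order logic cannot match braces in general, but it can up to a fixed nesting depth: a factor
is a tree of depth at most $d$ iff it is enclosed by a left and a right brace and its inside is
covered by trees of depth less than $d$ (`isBlock_succ_iff`). Once blocks are recognised, so are the
children of a node (`EncAt.isChild_iff`), and equality, $\prec$ and orderedness are expressed by
recursion on the depth. Each recursion is arranged to call itself only once. This makes `block` and
`child` linear, `sameSet` quadratic, `prec` cubic and `ordered` quartic in the depth bound.

Among sets of rank at most $n+1$, $V_{n+1}$ is the one that contains $\emptyset$ and is closed under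
adjoining elements of rank less than $n$ (`val_eq_vonNeumann_iff`). Ordered forests with equal
values are equal (`Ordered.eq_of_val_eq`), so the sentence `describeLevel i` has exactly one model.
Its size is $O(i^4)$, within the required $O(i^5)$.

Both maxima exist because there are only finitely many sentences of each size, and a defined word is
the longest model of its sentence. The bounds are attained at $n = c\,i^5$. -/

/-! ### Asymmetry of the order on sets -/

/-- Witnesses $z \in y \setminus x$ and $t \in x \setminus y$ for the two directions would satisfy
both $t \prec z$ and $z \prec t$, which the induction excludes. -/
theorem SetPrec.asymm {x y : ZFSet.{0}} (h : SetPrec x y) : ¬ SetPrec y x := by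
  induction h with
  | intro x y z hzy hzx _ ih =>
    rintro ⟨_, _, t, htx, hty, h'⟩
    exact ih t htx hty (h' z hzy hzx)

theorem SetPrec.irrefl (x : ZFSet.{0}) : ¬ SetPrec x x := fun h => h.asymm h

/-! ### Forests as notations for hereditarily finite sets -/

/-- Finite ordered forests. In `cons a b` the first tree has the forest `a` below its root, and `b`
consists of the other trees. A forest also stands for the tree that has it below its root. -/
inductive Forest : Type
  | nil
  | cons (a b : Forest)

namespace Forest

/-- The forests below the roots, in order. -/
def toList : Forest → List Forest
  | nil => []
  | cons a b => a :: b.toList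

/-- The forest with given forests below its roots. -/
def ofList : List Forest → Forest
  | [] => nil
  | a :: L => cons a (ofList L)

@[simp] theorem toList_ofList (L : List Forest) : (ofList L).toList = L := by
  induction L with
  | nil => rfl
  | cons a L ih => simp [ofList, toList, ih]

/-- The brace word of a forest. -/
def code : Forest → Word
  | nil => []
  | cons a b => Brace.l :: (a.code ++ Brace.r :: b.code)

/-- The brace word of the tree with the forest `a` below its root. -/
def enc (a : Forest) : Word := Brace.l :: (a.code ++ [Brace.r])

/-- The hereditarily finite set that a forest represents. -/
noncomputable def val : Forest → ZFSet.{0}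
  | nil => ∅
  | cons a b => insert a.val b.val

/-- This is the rank of the represented set, by `val_subset_vonNeumann`. -/
def depth : Forest → ℕ
  | nil => 0
  | cons a b => max (a.depth + 1) b.depth

/-- The children of each node increase strictly with respect to `SetPrec`. -/
def Ordered : Forest → Prop
  | nil => True
  | cons a b => a.Ordered ∧ b.Ordered ∧ ∀ c ∈ b.toList, SetPrec a.val c.val

theorem mem_val {a : Forest} {x : ZFSet.{0}} : x ∈ a.val ↔ ∃ b ∈ a.toList, b.val = x := by
  induction a with
  | nil => simp [val, toList]
  | cons a b _ ih => simp [val, toList, ih, eq_comm]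

theorem depth_le_iff {a : Forest} {n : ℕ} : a.depth ≤ n ↔ ∀ b ∈ a.toList, b.depth < n := by
  induction a with
  | nil => simp [depth, toList]
  | cons a b _ ih => simp [depth, toList, ih]

theorem ordered_iff {a : Forest} : a.Ordered ↔
    a.toList.Pairwise (fun b c => SetPrec b.val c.val) ∧ ∀ b ∈ a.toList, b.Ordered := by
  induction a with
  | nil => simp [Ordered, toList]
  | cons a b _ ih => simp only [Ordered, toList, ih, List.pairwise_cons, List.mem_cons,
      forall_eq_or_imp]; tauto

theorem code_eq_flatten (a : Forest) : a.code = (a.toList.map enc).flatten := by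
  induction a with
  | nil => simp [code, toList]
  | cons a b _ ih => simp [code, toList, enc, ih]

/-- Structural induction goes through once the claim also covers all trees of the forest. -/
theorem induction_toList {P : Forest → Prop} (h : ∀ a, (∀ b ∈ a.toList, P b) → P a)
    (a : Forest) : P a := by
  have key : P a ∧ ∀ b ∈ a.toList, P b := by
    induction a with
    | nil => exact ⟨h _ (by simp [toList]), by simp [toList]⟩
    | cons a b iha ihb =>
      have : ∀ c ∈ (cons a b).toList, P c := by
        simpa [toList] using ⟨iha.1, ihb.2⟩
      exact ⟨h _ this, this⟩
  exact key.1

/-- The heads are the least elements of the same set: if they differed, each would precede the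
other. Since a head does not occur in its own tail, removing it leaves tails of equal value. -/
theorem Ordered.eq_of_val_eq {a b : Forest} (ha : a.Ordered) (hb : b.Ordered)
    (h : a.val = b.val) : a = b := by
  induction a generalizing b with
  | nil =>
    cases b with
    | nil => rfl
    | cons b c =>
      have : b.val ∈ (∅ : ZFSet) := by rw [val] at h; rw [h]; simp [val]
      simp at this
  | cons a₁ a₂ ih₁ ih₂ =>
    cases b with
    | nil =>
      have : a₁.val ∈ (∅ : ZFSet) := by rw [val, val] at h; rw [← h]; simp
      simp at this
    | cons b₁ b₂ =>
      obtain ⟨ha₁, ha₂, ha⟩ := ha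
      obtain ⟨hb₁, hb₂, hb⟩ := hb
      simp only [val] at h
      have ha' : ∀ x ∈ a₂.val, SetPrec a₁.val x := fun x hx => by
        obtain ⟨c, hc, rfl⟩ := mem_val.1 hx
        exact ha c hc
      have hb' : ∀ x ∈ b₂.val, SetPrec b₁.val x := fun x hx => by
        obtain ⟨c, hc, rfl⟩ := mem_val.1 hx
        exact hb c hc
      have h1 : a₁.val = b₁.val := by
        have e1 : a₁.val = b₁.val ∨ a₁.val ∈ b₂.val := by
          rw [← ZFSet.mem_insert_iff, ← h]; simp
        have e2 : b₁.val = a₁.val ∨ b₁.val ∈ a₂.val := by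
          rw [← ZFSet.mem_insert_iff, h]; simp
        rcases e1 with e1 | e1
        · exact e1
        rcases e2 with e2 | e2
        · exact e2.symm
        exact absurd (ha' _ e2) (hb' _ e1).asymm
      have h2 : a₂.val = b₂.val := by
        ext x
        have hx : x ∈ insert a₁.val a₂.val ↔ x ∈ insert b₁.val b₂.val := by rw [h]
        rw [ZFSet.mem_insert_iff, ZFSet.mem_insert_iff, ← h1] at hx
        rw [← h1] at hb'
        constructor
        · intro hm
          rcases hx.1 (Or.inr hm) with rfl | h'
          · exact absurd (ha' _ hm) (SetPrec.irrefl _)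
          · exact h'
        · intro hm
          rcases hx.2 (Or.inr hm) with rfl | h'
          · exact absurd (hb' _ hm) (SetPrec.irrefl _)
          · exact h'
      rw [ih₁ ha₁ hb₁ h1, ih₂ ha₂ hb₂ h2]

theorem val_subset_vonNeumann {a : Forest} {n : ℕ} :
    a.val ⊆ ZFSet.vonNeumann (n : Ordinal.{0}) ↔ a.depth ≤ n := by
  induction a generalizing n with
  | nil => simp [val, depth]
  | cons a b iha ihb =>
    have h : a.val ∈ ZFSet.vonNeumann (n : Ordinal.{0}) ↔ a.depth < n := by
      cases n with
      | zero => simp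
      | succ n =>
        rw [Nat.cast_succ, ZFSet.vonNeumann_add_one, ZFSet.mem_powerset,
          iha, Nat.lt_succ_iff]
    simp only [val, depth, max_le_iff, Nat.succ_le_iff, ← h, ← ihb]
    constructor
    · exact fun hs => ⟨hs (by simp), fun x hx => hs (by simp [hx])⟩
    · rintro ⟨h1, h2⟩ x hx
      rcases ZFSet.mem_insert_iff.1 hx with rfl | hx
      · exact h1
      · exact h2 hx

/-! ### The levels of the cumulative hierarchy -/

/-- The subsequences of a list of forests, in the order of binary counting. -/
def subforests : List Forest → List Forest
  | [] => [nil]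
  | a :: L => (subforests L).flatMap fun s => [s, cons a s]

theorem length_subforests (L : List Forest) : (subforests L).length = 2 ^ L.length := by
  induction L with
  | nil => rfl
  | cons a L ih => simp [subforests, ih, pow_succ]

theorem mem_of_mem_subforests {L : List Forest} {s : Forest} (hs : s ∈ subforests L) {c : Forest}
    (hc : c ∈ s.toList) : c ∈ L := by
  induction L generalizing s with
  | nil =>
    simp only [subforests, List.mem_singleton] at hs
    subst hs
    simp [toList] at hc
  | cons a L ih =>
    simp only [subforests, List.mem_flatMap, List.mem_cons, List.not_mem_nil, or_false] at hs
    obtain ⟨t, ht, rfl | rfl⟩ := hs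
    · exact List.mem_cons_of_mem _ (ih ht hc)
    · rcases List.mem_cons.1 hc with rfl | hc
      · simp
      · exact List.mem_cons_of_mem _ (ih ht hc)

theorem ordered_of_mem_subforests {L : List Forest} (hL : (ofList L).Ordered) {s : Forest}
    (hs : s ∈ subforests L) : s.Ordered := by
  induction L generalizing s with
  | nil =>
    simp only [subforests, List.mem_singleton] at hs
    subst hs
    trivial
  | cons a L ih =>
    simp only [subforests, List.mem_flatMap, List.mem_cons, List.not_mem_nil, or_false] at hs
    obtain ⟨h1, h2, h3⟩ := hL
    rw [toList_ofList] at h3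
    obtain ⟨t, ht, rfl | rfl⟩ := hs
    · exact ih h2 ht
    · exact ⟨h1, ih h2 ht, fun c hc => h3 c (mem_of_mem_subforests ht hc)⟩

/-- The head `a` is the least significant bit. If `z` witnesses $s \prec t$ for subsequences of the
tail, then $a \prec z$, so adjoining `a` to either side leaves `z` a witness. -/
theorem pairwise_subforests {L : List Forest} (hL : (ofList L).Ordered) :
    (subforests L).Pairwise (fun b c => SetPrec b.val c.val) := by
  induction L with
  | nil => simp [subforests]
  | cons a L ih =>
    obtain ⟨_, h2, h3⟩ := hL
    rw [toList_ofList] at h3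
    have hlt : ∀ s ∈ subforests L, ∀ x ∈ s.val, SetPrec a.val x := by
      intro s hs x hx
      obtain ⟨c, hc, rfl⟩ := mem_val.1 hx
      exact h3 c (mem_of_mem_subforests hs hc)
    have hne : ∀ s ∈ subforests L, a.val ∉ s.val := fun s hs h => SetPrec.irrefl _ (hlt s hs _ h)
    rw [subforests, List.flatMap, List.pairwise_flatten]
    constructor
    · intro M hM
      obtain ⟨s, hs, rfl⟩ := List.mem_map.1 hM
      simp only [List.pairwise_cons, List.mem_singleton, forall_eq, List.not_mem_nil,
        false_imp_iff, implies_true, List.Pairwise.nil, and_true, val]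
      exact .intro _ _ a.val (by simp) (hne s hs) (fun b hb hb' => absurd (by simp [hb]) hb')
    · rw [List.pairwise_map]
      refine (ih h2).imp_of_mem ?_
      intro s t hs ht hst
      obtain ⟨_, _, z, hzt, hzs, h⟩ := hst
      have hza : z ≠ a.val := fun h => hne t ht (h ▸ hzt)
      have haz := hlt t ht z hzt
      simp only [List.mem_cons, List.not_mem_nil, or_false, forall_eq_or_imp, forall_eq, val]
      refine ⟨⟨.intro _ _ z hzt hzs h, .intro _ _ z (by simp [hzt]) hzs ?_⟩,
        .intro _ _ z hzt (by simp [hza, hzs]) ?_,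
        .intro _ _ z (by simp [hzt]) (by simp [hza, hzs]) ?_⟩
      · exact fun b hb hb' => h b hb fun hb'' => hb' (by simp [hb''])
      · intro b hb hb'
        rcases ZFSet.mem_insert_iff.1 hb with rfl | hb
        · exact haz
        · exact h b hb hb'
      · intro b hb hb'
        rcases ZFSet.mem_insert_iff.1 hb with rfl | hb
        · exact haz
        · exact h b hb fun hb'' => hb' (by simp [hb''])

theorem exists_mem_subforests {L : List Forest} {x : ZFSet.{0}} :
    (∃ s ∈ subforests L, s.val = x) ↔ x ⊆ (ofList L).val := by
  induction L generalizing x with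
  | nil =>
    simp only [subforests, List.mem_singleton, exists_eq_left, ofList, val]
    constructor
    · rintro rfl
      exact fun _ h => h
    · intro h
      ext z
      exact ⟨fun hz => absurd hz (ZFSet.notMem_empty z), fun hz => h hz⟩
  | cons a L ih =>
    simp only [subforests, List.mem_flatMap, List.mem_cons, List.not_mem_nil, or_false, ofList, val]
    constructor
    · rintro ⟨_, ⟨s, hs, rfl | rfl⟩, rfl⟩ z hz
      · exact ZFSet.mem_insert_of_mem _ (ih.1 ⟨_, hs, rfl⟩ hz)
      · rcases ZFSet.mem_insert_iff.1 hz with rfl | hz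
        · simp
        · exact ZFSet.mem_insert_of_mem _ (ih.1 ⟨_, hs, rfl⟩ hz)
    · intro hx
      obtain ⟨s, hs, hsx⟩ := (ih (x := ZFSet.sep (· ≠ a.val) x)).2 (fun z hz => by
        obtain ⟨hz, hne⟩ := ZFSet.mem_sep.1 hz
        exact (ZFSet.mem_insert_iff.1 (hx hz)).resolve_left hne)
      by_cases ha : a.val ∈ x
      · refine ⟨_, ⟨s, hs, Or.inr rfl⟩, ?_⟩
        ext z
        simp only [val, hsx, ZFSet.mem_insert_iff, ZFSet.mem_sep]
        by_cases hz : z = a.val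
        · simp [hz, ha]
        · simp [hz]
      · refine ⟨_, ⟨s, hs, Or.inl rfl⟩, ?_⟩
        ext z
        simp only [hsx, ZFSet.mem_sep]
        exact ⟨fun h => h.1, fun h => ⟨h, fun e => ha (e ▸ h)⟩⟩

/-- The elements of the `n`-th level of the cumulative hierarchy, as forests. -/
def levelList : ℕ → List Forest
  | 0 => []
  | n + 1 => subforests (levelList n)

/-- The `n`-th level of the cumulative hierarchy. -/
def level (n : ℕ) : Forest := ofList (levelList n)

theorem ordered_level (n : ℕ) : (level n).Ordered := by
  induction n with
  | zero => trivial
  | succ n ih =>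
    rw [level, ordered_iff, toList_ofList]
    exact ⟨pairwise_subforests ih, fun b hb => ordered_of_mem_subforests ih hb⟩

theorem val_level (n : ℕ) : (level n).val = ZFSet.vonNeumann (n : Ordinal.{0}) := by
  induction n with
  | zero => simp [level, levelList, ofList, val]
  | succ n ih =>
    ext x
    rw [Nat.cast_succ, ZFSet.vonNeumann_add_one, ZFSet.mem_powerset, ← ih,
      mem_val, level, toList_ofList, level, ← exists_mem_subforests, levelList]

theorem length_levelList (n : ℕ) : (levelList (n + 1)).length = tower n := by
  induction n with
  | zero => rfl
  | succ n ih => rw [levelList, length_subforests, ih, tower]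

theorem length_toList_le (a : Forest) : a.toList.length ≤ a.code.length := by
  induction a with
  | nil => simp [toList]
  | cons a b _ ih =>
    simp only [toList, code, List.length_cons, List.length_append]
    omega

theorem tower_le_length_enc (n : ℕ) : tower n ≤ (level (n + 1)).enc.length := by
  have := length_toList_le (level (n + 1))
  rw [level, toList_ofList, length_levelList] at this
  simp only [enc, level, List.length_cons, List.length_append]
  omega

theorem orderedEncoding_enc {a : Forest} (ha : a.Ordered) : OrderedEncoding a.enc a.val := by
  induction a using induction_toList with
  | h a ih =>
    obtain ⟨h1, h2⟩ := ordered_iff.1 ha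
    have := OrderedEncoding.intro a.toList.length (fun j => (a.toList.get j).enc)
      (fun j => (a.toList.get j).val) a.val
      (fun z => by
        rw [mem_val]
        constructor
        · rintro ⟨b, hb, rfl⟩
          obtain ⟨j, rfl⟩ := List.mem_iff_get.1 hb
          exact ⟨j, rfl⟩
        · rintro ⟨j, rfl⟩
          exact ⟨_, List.get_mem _ _, rfl⟩)
      (fun i j hij => List.pairwise_iff_get.1 h1 i j hij)
      (fun j => ih _ (List.get_mem _ _) (h2 _ (List.get_mem _ _)))
    have e : List.ofFn (fun j => (a.toList.get j).enc) = a.toList.map enc := by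
      rw [← Function.comp_def enc, ← List.map_ofFn, List.ofFn_get]
    rwa [e, ← code_eq_flatten] at this

theorem exists_of_orderedEncoding {w : Word} {x : ZFSet.{0}} (h : OrderedEncoding w x) :
    ∃ a : Forest, w = a.enc ∧ a.Ordered ∧ a.val = x := by
  induction h with
  | intro k ws xs x helem hord _ ih =>
    choose f hf1 hf2 hf3 using ih
    refine ⟨ofList (List.ofFn f), ?_, ?_, ?_⟩
    · rw [enc, code_eq_flatten, toList_ofList, List.map_ofFn]
      congr
      exact funext hf1
    · rw [ordered_iff, toList_ofList, List.pairwise_ofFn]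
      refine ⟨fun i j hij => ?_, fun b hb => ?_⟩
      · rw [hf3, hf3]
        exact hord i j hij
      · obtain ⟨j, rfl⟩ := List.mem_ofFn.1 hb
        exact hf2 j
    · ext z
      rw [mem_val, toList_ofList, helem]
      constructor
      · rintro ⟨b, hb, rfl⟩
        obtain ⟨j, rfl⟩ := List.mem_ofFn.1 hb
        exact ⟨j, (hf3 j).symm⟩
      · rintro ⟨j, rfl⟩
        exact ⟨f j, List.mem_ofFn.2 ⟨j, rfl⟩, hf3 j⟩

theorem eq_level_iff {a : Forest} {n : ℕ} :
    a.Ordered ∧ a.val = ZFSet.vonNeumann (n : Ordinal.{0}) ↔ a = level n := by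
  constructor
  · rintro ⟨h1, h2⟩
    exact h1.eq_of_val_eq (ordered_level n) (h2.trans (val_level n).symm)
  · rintro rfl
    exact ⟨ordered_level n, val_level n⟩

theorem orderedEncoding_vonNeumann_iff (n : ℕ) (w : Word) :
    OrderedEncoding w (ZFSet.vonNeumann (n : Ordinal.{0})) ↔ w = (level n).enc := by
  constructor
  · intro h
    obtain ⟨a, rfl, ha⟩ := exists_of_orderedEncoding h
    rw [eq_level_iff.1 ha]
  · rintro rfl
    rw [← val_level]
    exact orderedEncoding_enc (ordered_level n)

end Forest

open Forest

/-! ### Unique readability and nesting heights -/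

namespace Forest

theorem code_append_cancel {a b : Forest} {u v : Word}
    (h : a.code ++ Brace.r :: u = b.code ++ Brace.r :: v) : a = b := by
  -- The remainders must be carried along, since the second tail is compared only after the first
  -- subtree is cancelled.
  suffices a = b ∧ u = v from this.1
  induction a generalizing b u v with
  | nil =>
    cases b with
    | nil => simpa [code] using h
    | cons b c => simp [code] at h
  | cons a₁ a₂ ih₁ ih₂ =>
    cases b with
    | nil => simp [code] at h
    | cons b₁ b₂ =>
      simp only [code, List.cons_append, List.append_assoc, List.cons.injEq, true_and] at h
      obtain ⟨rfl, h1⟩ := ih₁ h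
      obtain ⟨rfl, h2⟩ := ih₂ h1
      exact ⟨rfl, h2⟩

end Forest

/-- The number of left braces minus the number of right braces. -/
def balance : Word → ℤ
  | [] => 0
  | Brace.l :: w => balance w + 1
  | Brace.r :: w => balance w - 1

@[simp] theorem balance_append (u v : Word) : balance (u ++ v) = balance u + balance v := by
  induction u with
  | nil => simp [balance]
  | cons a u ih => cases a <;> simp only [List.cons_append, balance, ih] <;> ring

@[simp] theorem balance_code (a : Forest) : balance a.code = 0 := by
  induction a with
  | nil => rfl
  | cons a b iha ihb => simp [code, balance, iha, ihb]

theorem balance_take_code (a : Forest) (n : ℕ) : 0 ≤ balance (a.code.take n) := by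
  induction a generalizing n with
  | nil => simp [code, balance]
  | cons a b iha ihb =>
    cases n with
    | zero => simp [balance]
    | succ n =>
      rw [code, List.take_succ_cons, balance, List.take_append, balance_append]
      have h1 := iha n
      cases n - a.code.length with
      | zero => simp only [List.take_zero, balance]; omega
      | succ m =>
        have h2 := ihb m
        simp only [List.take_succ_cons, balance]
        omega

/-- The nesting level of a position in a word. -/
def height (w : Word) (n : ℕ) : ℤ := balance (w.take n)

theorem height_add {w u v : Word} {p : ℕ} (h : w.drop p = u ++ v) {n : ℕ} (hn : n ≤ u.length) :
    height w (p + n) = height w p + balance (u.take n) := by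
  rw [height, List.take_add, balance_append, h, List.take_append_of_le_length hn, height]

/-- The factor of `w` that starts at position `p` is the word of the tree given by `a`. -/
def EncAt (w : Word) (p : ℕ) (a : Forest) : Prop :=
  ∃ v, w.drop p = Brace.l :: (a.code ++ Brace.r :: v)

namespace EncAt

variable {w : Word} {p q : ℕ} {a b : Forest}

theorem unique (ha : EncAt w p a) (hb : EncAt w p b) : a = b := by
  obtain ⟨u, hu⟩ := ha
  obtain ⟨v, hv⟩ := hb
  rw [hu, List.cons.injEq] at hv
  exact code_append_cancel hv.2

theorem drop_succ (h : EncAt w p a) : ∃ v, w.drop (p + 1) = a.code ++ Brace.r :: v := by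
  obtain ⟨v, hv⟩ := h
  refine ⟨v, ?_⟩
  rw [← List.drop_drop, hv, List.drop_succ_cons, List.drop_zero]

theorem lt_length (h : EncAt w p a) : p + a.code.length + 1 < w.length := by
  obtain ⟨v, hv⟩ := h
  have := congrArg List.length hv
  simp only [List.length_drop, List.length_cons, List.length_append] at this
  omega

/-- The opening brace adds one to the nonnegative balance of a prefix of `a.code`. Heights are taken
before the letter is read, so the closing brace is included. -/
theorem height_lt (h : EncAt w p a) {n : ℕ} (h1 : p < n) (h2 : n ≤ p + a.code.length + 1) :
    height w p < height w n := by
  obtain ⟨v, hv⟩ := h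
  obtain ⟨m, rfl⟩ : ∃ m, n = p + (m + 1) := ⟨n - p - 1, by omega⟩
  rw [height_add (u := Brace.l :: a.code) (v := Brace.r :: v) (by simpa using hv)
    (by simp only [List.length_cons]; omega), List.take_succ_cons, balance]
  have := balance_take_code a m
  omega

theorem height_end (h : EncAt w p a) : height w (p + a.code.length + 2) = height w p := by
  obtain ⟨v, hv⟩ := h
  rw [add_assoc, height_add (u := Brace.l :: a.code ++ [Brace.r]) (v := v) (by simpa using hv)
    (by simp), List.take_of_length_le (by simp)]
  simp [balance]

theorem height_succ (h : EncAt w p a) : height w (p + 1) = height w p + 1 := by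
  obtain ⟨v, hv⟩ := h
  rw [height_add (u := [Brace.l]) (v := a.code ++ Brace.r :: v) (by simpa using hv) (by simp)]
  simp [balance]

end EncAt

/-! ### Positions of the trees of a forest -/

namespace Forest

/-- The positions and the values of the trees of a forest whose word starts at position `p`. -/
def trees : Forest → ℕ → List (ℕ × Forest)
  | nil, _ => []
  | cons a b, p => (p, a) :: b.trees (p + a.code.length + 2)

theorem mem_toList_iff {a b : Forest} {p : ℕ} : b ∈ a.toList ↔ ∃ q, (q, b) ∈ a.trees p := by
  induction a generalizing p with
  | nil => simp [toList, trees]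
  | cons a c _ ih => simp [toList, trees, ih (p := p + a.code.length + 2), exists_or]

theorem le_of_mem_trees {a b : Forest} {p q : ℕ} (h : (q, b) ∈ a.trees p) :
    p ≤ q ∧ q + b.code.length + 2 ≤ p + a.code.length := by
  induction a generalizing p with
  | nil => simp [trees] at h
  | cons a c _ ih =>
    simp only [trees, List.mem_cons, Prod.mk.injEq] at h
    simp only [code, List.length_cons, List.length_append]
    rcases h with ⟨rfl, rfl⟩ | h
    · omega
    · have := ih h
      omega

theorem exists_mem_trees {a : Forest} {p z : ℕ} (h1 : p ≤ z) (h2 : z < p + a.code.length) :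
    ∃ q b, (q, b) ∈ a.trees p ∧ q ≤ z ∧ z ≤ q + b.code.length + 1 := by
  induction a generalizing p with
  | nil => simp only [code, List.length_nil] at h2; omega
  | cons a c _ ih =>
    simp only [code, List.length_cons, List.length_append] at h2
    by_cases hz : z ≤ p + a.code.length + 1
    · exact ⟨p, a, by simp [trees], h1, hz⟩
    · obtain ⟨q, b, h, h'⟩ := ih (p := p + a.code.length + 2) (by omega) (by omega)
      exact ⟨q, b, by simp [trees, h], h'⟩

theorem encAt_of_mem_trees {a b : Forest} {w v : Word} {p q : ℕ} (hw : w.drop p = a.code ++ v)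
    (h : (q, b) ∈ a.trees p) : EncAt w q b ∧ height w q = height w p := by
  induction a generalizing p with
  | nil => simp [trees] at h
  | cons a c _ ih =>
    have ha : EncAt w p a := ⟨c.code ++ v, by simpa [code] using hw⟩
    simp only [trees, List.mem_cons, Prod.mk.injEq] at h
    rcases h with ⟨rfl, rfl⟩ | h
    · exact ⟨ha, rfl⟩
    · have := ih (p := p + a.code.length + 2) (by
        rw [add_assoc, ← List.drop_drop, hw, code]
        simp [← List.drop_drop]) h
      rwa [ha.height_end] at this

/-- Starting positions increase from left to right, so the order of siblings can be read off with
`<` on positions. -/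
theorem pairwise_toList_iff {R : Forest → Forest → Prop} {a : Forest} {p : ℕ} :
    a.toList.Pairwise R ↔ ∀ q b q' b', (q, b) ∈ a.trees p → (q', b') ∈ a.trees p → q < q' →
      R b b' := by
  induction a generalizing p with
  | nil => simp [toList, trees]
  | cons a c _ ih =>
    rw [toList, List.pairwise_cons, ih (p := p + a.code.length + 2)]
    simp only [trees, List.mem_cons, Prod.mk.injEq]
    constructor
    · rintro ⟨h1, h2⟩ q b q' b' (⟨rfl, rfl⟩ | h) (⟨rfl, rfl⟩ | h') hlt
      · omega
      · exact h1 _ (mem_toList_iff.2 ⟨_, h'⟩)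
      · have := le_of_mem_trees h
        omega
      · exact h2 _ _ _ _ h h' hlt
    · refine fun h => ⟨fun b hb => ?_, fun q b q' b' hq hq' => h q b q' b' (.inr hq) (.inr hq')⟩
      obtain ⟨q, hq⟩ := mem_toList_iff (p := p + a.code.length + 2).1 hb
      have := le_of_mem_trees hq
      exact h _ _ _ _ (.inl ⟨rfl, rfl⟩) (.inr hq) (by omega)

end Forest

/-! ### Blocks of bounded depth and their children -/

/-- The factor of `w` from position `x` to position `y` is the word of a tree of depth less
than `d`. -/
def IsBlock (w : Word) (d x y : ℕ) : Prop :=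
  ∃ a : Forest, a.depth < d ∧ EncAt w x a ∧ y = x + a.code.length + 1

theorem IsBlock.height_lt {w : Word} {d x y n : ℕ} (h : IsBlock w d x y) (h1 : x < n)
    (h2 : n ≤ y) : height w x < height w n := by
  obtain ⟨a, _, ha, rfl⟩ := h
  exact ha.height_lt h1 h2

theorem IsBlock.lt {w : Word} {d x y : ℕ} (h : IsBlock w d x y) : x < y := by
  obtain ⟨a, _, ha, rfl⟩ := h
  omega

theorem IsBlock.lt_length {w : Word} {d x y : ℕ} (h : IsBlock w d x y) : y < w.length := by
  obtain ⟨a, _, ha, rfl⟩ := h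
  exact ha.lt_length

theorem EncAt.isBlock_iff {w : Word} {d x y : ℕ} {a : Forest} (ha : EncAt w x a) :
    IsBlock w d x y ↔ a.depth < d ∧ y = x + a.code.length + 1 := by
  constructor
  · rintro ⟨b, hb, hb', h⟩
    obtain rfl := ha.unique hb'
    exact ⟨hb, h⟩
  · exact fun h => ⟨a, h.1, ha, h.2⟩

/-- Blocks that cover an interval make it the word of a forest. -/
theorem exists_forest_of_cover {w : Word} {d x y : ℕ} (hy : y ≤ w.length)
    (hc : ∀ z, x ≤ z → z < y → ∃ u v, x ≤ u ∧ u ≤ z ∧ z ≤ v ∧ v < y ∧ IsBlock w d u v)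
    {p : ℕ} (hxp : x ≤ p) (hpy : p ≤ y) (hp : height w p = height w x)
    (hle : ∀ z, x ≤ z → z ≤ p → height w x ≤ height w z) :
    ∃ a : Forest, a.depth ≤ d ∧ w.drop p = a.code ++ w.drop y := by
  obtain rfl | hlt := hpy.eq_or_lt
  · exact ⟨nil, by simp [depth], by simp [code]⟩
  obtain ⟨u, v, h1, h2, h3, h4, hb⟩ := hc p hxp hlt
  -- A block that began before `p` would have smaller height at its start than at `p`, but `p`
  -- already has the least height on this stretch. So the block that covers `p` starts there, and
  -- the argument repeats from its end.
  obtain rfl : u = p := by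
    by_contra hne
    have := hb.height_lt (n := p) (by omega) h3
    have := hle u h1 h2
    omega
  obtain ⟨b, hbd, hbe, rfl⟩ := hb
  obtain ⟨a, had, hae⟩ := exists_forest_of_cover hy hc (p := u + b.code.length + 2) (by omega)
    (by omega) (by rw [hbe.height_end, hp]) (fun z hz hz' => by
      rcases le_or_gt z u with hzu | hzu
      · exact hle z hz hzu
      · obtain rfl | hz' := hz'.eq_or_lt
        · rw [hbe.height_end, hp]
        · have := hbe.height_lt hzu (by omega)
          omega)
  refine ⟨cons b a, by simp only [depth]; omega, ?_⟩
  obtain ⟨v, hv⟩ := hbe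
  have : v = w.drop (u + b.code.length + 2) := by
    rw [add_assoc, ← List.drop_drop, hv]
    simp [← List.drop_drop]
  rw [hv, code, this, hae]
  simp
termination_by y - p

/-- Covering replaces any counting of braces. The condition mentions depth `d` only once, which
keeps the formula `block` linear in size. -/
theorem isBlock_succ_iff {w : Word} {d x y : ℕ} (hy : y < w.length) (hxy : x < y) :
    IsBlock w (d + 1) x y ↔ w[x] = Brace.l ∧ w[y] = Brace.r ∧
      ∀ z, x < z → z < y → ∃ u v, x < u ∧ u ≤ z ∧ z ≤ v ∧ v < y ∧ IsBlock w d u v := by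
  constructor
  · rintro ⟨a, had, ha, rfl⟩
    refine ⟨?_, ?_, fun z hz hz' => ?_⟩
    · obtain ⟨v, hv⟩ := ha
      have := List.drop_eq_getElem_cons (i := x) (l := w) (by omega)
      rw [hv, List.cons.injEq] at this
      exact this.1.symm
    · obtain ⟨v, hv⟩ := ha
      have h : w.drop (x + a.code.length + 1) = Brace.r :: v := by
        rw [add_assoc, ← List.drop_drop, hv]
        simp
      rw [List.drop_eq_getElem_cons hy, List.cons.injEq] at h
      exact h.1
    · obtain ⟨v, hv⟩ := ha.drop_succ
      obtain ⟨q, b, hb, h1, h2⟩ := exists_mem_trees (a := a) (p := x + 1) (z := z) (by omega)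
        (by omega)
      have hle := le_of_mem_trees hb
      refine ⟨q, q + b.code.length + 1, by omega, h1, h2, by omega, b, ?_,
        (encAt_of_mem_trees hv hb).1, rfl⟩
      exact depth_le_iff.1 (Nat.lt_succ_iff.1 had) b (mem_toList_iff.2 ⟨q, hb⟩)
  · rintro ⟨hl, hr, hc⟩
    obtain ⟨a, had, ha⟩ := exists_forest_of_cover (x := x + 1) (p := x + 1) hy.le hc le_rfl hxy rfl
      (fun z h1 h2 => by rw [le_antisymm h2 h1])
    have hx := List.drop_eq_getElem_cons (i := x) (l := w) (by omega)
    have hy' := List.drop_eq_getElem_cons (i := y) (l := w) hy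
    rw [hl, ha, hy', hr] at hx
    refine ⟨a, by omega, ⟨_, hx⟩, ?_⟩
    have := congrArg List.length hx
    simp only [List.length_drop, List.length_cons, List.length_append] at this
    omega

/-- The position `c` lies in the block of depth less than `d` that starts at `x`, and every block of
depth less than `d` that starts between `x` and `c` ends before `c`. -/
def IsChild (w : Word) (d x c : ℕ) : Prop :=
  ∃ y, IsBlock w d x y ∧ x < c ∧ c < y ∧ ∀ u v, x < u → u < c → IsBlock w d u v → v < c

/-- Any position inside lies in the block of some child; if it is not the first position there, that
block starts earlier and does not end before it. Conversely, a block starting between `x` and a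
child's start and reaching that start would begin at a height strictly between two consecutive
integers. -/
theorem EncAt.isChild_iff {w : Word} {d x c : ℕ} {a : Forest} (ha : EncAt w x a)
    (had : a.depth < d) : IsChild w d x c ↔ ∃ b, (c, b) ∈ a.trees (x + 1) := by
  obtain ⟨w', hw'⟩ := ha.drop_succ
  have hd : ∀ q b, (q, b) ∈ a.trees (x + 1) → b.depth < d := fun q b h =>
    (depth_le_iff.1 le_rfl b (mem_toList_iff.2 ⟨q, h⟩)).trans had
  constructor
  · rintro ⟨y, hy, h1, h2, h3⟩
    obtain ⟨-, rfl⟩ := ha.isBlock_iff.1 hy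
    obtain ⟨q, b, hb, hq, hq'⟩ := exists_mem_trees (a := a) (p := x + 1) (z := c) (by omega)
      (by omega)
    have hle := le_of_mem_trees hb
    obtain rfl | hlt := hq.eq_or_lt
    · exact ⟨b, hb⟩
    · have := h3 q _ (by omega) hlt ⟨b, hd q b hb, (encAt_of_mem_trees hw' hb).1, rfl⟩
      omega
  · rintro ⟨b, hb⟩
    have hle := le_of_mem_trees hb
    refine ⟨_, ha.isBlock_iff.2 ⟨had, rfl⟩, by omega, by omega, fun u v hu huc huv => ?_⟩
    by_contra hcv
    have h1 := huv.height_lt huc (by omega)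
    have h2 := (encAt_of_mem_trees hw' hb).2
    have h3 := ha.height_lt hu (by omega)
    rw [ha.height_succ] at h2
    omega

theorem EncAt.exists_of_isChild {w : Word} {d x c : ℕ} {a : Forest} (ha : EncAt w x a)
    (had : a.depth < d) (h : IsChild w d x c) : ∃ b ∈ a.toList, EncAt w c b := by
  obtain ⟨b, hb⟩ := (ha.isChild_iff had).1 h
  obtain ⟨w', hw'⟩ := ha.drop_succ
  exact ⟨b, mem_toList_iff.2 ⟨c, hb⟩, (encAt_of_mem_trees hw' hb).1⟩

theorem EncAt.exists_isChild {w : Word} {d x : ℕ} {a b : Forest} (ha : EncAt w x a)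
    (had : a.depth < d) (h : b ∈ a.toList) : ∃ c, IsChild w d x c ∧ EncAt w c b := by
  obtain ⟨c, hc⟩ := (mem_toList_iff (p := x + 1)).1 h
  obtain ⟨w', hw'⟩ := ha.drop_succ
  exact ⟨c, (ha.isChild_iff had).2 ⟨b, hc⟩, (encAt_of_mem_trees hw' hc).1⟩

theorem EncAt.pairwise_iff {w : Word} {d x : ℕ} {a : Forest} (ha : EncAt w x a)
    (had : a.depth < d) {R : Forest → Forest → Prop} : a.toList.Pairwise R ↔
      ∀ c b c' b', IsChild w d x c → IsChild w d x c' → c < c' → EncAt w c b → EncAt w c' b' →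
        R b b' := by
  obtain ⟨w', hw'⟩ := ha.drop_succ
  rw [pairwise_toList_iff (p := x + 1)]
  constructor
  · intro h c b c' b' hc hc' hlt hb hb'
    obtain ⟨e, he⟩ := (ha.isChild_iff had).1 hc
    obtain ⟨e', he'⟩ := (ha.isChild_iff had).1 hc'
    rw [hb.unique (encAt_of_mem_trees hw' he).1, hb'.unique (encAt_of_mem_trees hw' he').1]
    exact h _ _ _ _ he he' hlt
  · exact fun h q b q' b' hb hb' hlt => h q b q' b' ((ha.isChild_iff had).2 ⟨b, hb⟩)
      ((ha.isChild_iff had).2 ⟨b', hb'⟩) hlt (encAt_of_mem_trees hw' hb).1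
      (encAt_of_mem_trees hw' hb').1

/-! ### Set relations in terms of children -/

namespace Forest

theorem val_eq_iff {a b : Forest} : a.val = b.val ↔
    (∀ c ∈ a.toList, ∃ e ∈ b.toList, c.val = e.val) ∧
      ∀ c ∈ b.toList, ∃ e ∈ a.toList, c.val = e.val := by
  constructor
  · intro h
    constructor
    · intro c hc
      obtain ⟨e, he, h'⟩ := mem_val.1 (h ▸ mem_val.2 ⟨c, hc, rfl⟩)
      exact ⟨e, he, h'.symm⟩
    · intro c hc
      obtain ⟨e, he, h'⟩ := mem_val.1 (h ▸ mem_val.2 ⟨c, hc, rfl⟩)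
      exact ⟨e, he, h'.symm⟩
  · rintro ⟨h1, h2⟩
    ext x
    rw [mem_val, mem_val]
    constructor
    · rintro ⟨c, hc, rfl⟩
      obtain ⟨e, he, h⟩ := h1 c hc
      exact ⟨e, he, h.symm⟩
    · rintro ⟨c, hc, rfl⟩
      obtain ⟨e, he, h⟩ := h2 c hc
      exact ⟨e, he, h.symm⟩

theorem setPrec_val_iff {a b : Forest} : SetPrec a.val b.val ↔
    ∃ z ∈ b.toList, (∀ c ∈ a.toList, ¬ c.val = z.val) ∧
      ∀ c ∈ a.toList, (∃ e ∈ b.toList, c.val = e.val) ∨ SetPrec c.val z.val := by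
  constructor
  · rintro ⟨_, _, z, hzb, hza, h⟩
    obtain ⟨z, hz, rfl⟩ := mem_val.1 hzb
    refine ⟨z, hz, fun c hc e => hza (mem_val.2 ⟨c, hc, e⟩), fun c hc => ?_⟩
    by_cases hcb : c.val ∈ b.val
    · obtain ⟨e, he, h'⟩ := mem_val.1 hcb
      exact .inl ⟨e, he, h'.symm⟩
    · exact .inr (h _ (mem_val.2 ⟨c, hc, rfl⟩) hcb)
  · rintro ⟨z, hz, h1, h2⟩
    refine .intro _ _ z.val (mem_val.2 ⟨z, hz, rfl⟩) ?_ ?_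
    · intro h
      obtain ⟨c, hc, e⟩ := mem_val.1 h
      exact h1 c hc e
    · intro x hx hxb
      obtain ⟨c, hc, rfl⟩ := mem_val.1 hx
      refine (h2 c hc).resolve_left ?_
      rintro ⟨e, he, h⟩
      exact hxb (mem_val.2 ⟨e, he, h.symm⟩)

theorem val_eq_insert_iff {a b c : Forest} : a.val = insert b.val c.val ↔
    (∃ e ∈ a.toList, e.val = b.val) ∧ (∀ e ∈ c.toList, ∃ f ∈ a.toList, e.val = f.val) ∧
      ∀ e ∈ a.toList, e.val = b.val ∨ ∃ f ∈ c.toList, e.val = f.val := by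
  rw [show insert b.val c.val = (cons b c).val from rfl, val_eq_iff]
  simp only [toList, List.mem_cons, forall_eq_or_imp, exists_eq_or_imp]
  rw [and_comm, and_assoc]
  simp only [eq_comm (a := b.val)]

theorem depth_lt_of_mem {a b : Forest} {n : ℕ} (h : b ∈ a.toList) (ha : a.depth < n) :
    b.depth < n :=
  (depth_le_iff.1 le_rfl b h).trans ha

theorem depth_lt_of_mem' {a b : Forest} {n : ℕ} (h : b ∈ a.toList) (ha : a.depth < n + 1) :
    b.depth < n :=
  depth_le_iff.1 (Nat.lt_succ_iff.1 ha) b h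

/-- A set contains the empty set and is closed under adjoining its elements of rank less than `n`
to its elements. -/
def Closed (n : ℕ) (a : Forest) : Prop :=
  (∃ c ∈ a.toList, ∀ e ∈ c.toList, False) ∧ ∀ c ∈ a.toList, ∀ y ∈ a.toList, y.depth < n →
    ∃ z ∈ a.toList, z.val = insert y.val c.val

/-- Every subset of $V_n$ arises from $\emptyset$ by adjoining elements of $V_n$ one at a time.
These are themselves subsets of $V_n$, so a closed set already contains them by induction. The
restriction to rank less than `n` keeps $V_{n+1}$ itself closed. -/
theorem val_eq_vonNeumann_iff {a : Forest} {n : ℕ} (ha : a.depth ≤ n + 1) :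
    a.val = ZFSet.vonNeumann ((n + 1 : ℕ) : Ordinal.{0}) ↔ a.Closed n := by
  have key : ∀ x, x ∈ ZFSet.vonNeumann ((n + 1 : ℕ) : Ordinal.{0}) ↔
      x ⊆ ZFSet.vonNeumann (n : Ordinal.{0}) := fun x => by
    rw [Nat.cast_succ, ZFSet.vonNeumann_add_one, ZFSet.mem_powerset]
  constructor
  · intro h
    constructor
    · have : (∅ : ZFSet.{0}) ∈ a.val := by
        rw [h, key]
        exact ZFSet.empty_subset _
      obtain ⟨c, hc, h0⟩ := mem_val.1 this
      refine ⟨c, hc, fun e he => ?_⟩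
      have := mem_val.2 ⟨e, he, rfl⟩
      rw [h0] at this
      exact ZFSet.notMem_empty _ this
    · intro c hc y hy hyn
      have : (cons y c).val ∈ a.val := by
        rw [h, key, val_subset_vonNeumann, depth]
        have := depth_lt_of_mem' hc (Nat.lt_succ_iff.2 ha)
        omega
      exact mem_val.1 this
  · rintro ⟨⟨c₀, hc₀, h0⟩, h1⟩
    refine subset_antisymm (val_subset_vonNeumann.2 ha) ?_
    have all : ∀ b : Forest, b.depth ≤ n → b.val ∈ a.val := by
      intro b hb
      induction b with
      | nil =>
        have : c₀.val = ∅ := by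
          rw [ZFSet.eq_empty]
          intro x hx
          obtain ⟨e, he, -⟩ := mem_val.1 hx
          exact h0 e he
        rw [val, ← this]
        exact mem_val.2 ⟨c₀, hc₀, rfl⟩
      | cons b c ihb ihc =>
        simp only [depth, max_le_iff, Nat.succ_le_iff] at hb
        obtain ⟨y, hy, hyb⟩ := mem_val.1 (ihb hb.1.le)
        obtain ⟨c', hc', hcc⟩ := mem_val.1 (ihc hb.2)
        -- `y` may differ from `b` as a forest, but depth depends only on the value.
        have hyn : y.depth < n := by
          cases n with
          | zero => exact absurd hb.1 (Nat.not_lt_zero _)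
          | succ n =>
            rw [Nat.lt_succ_iff, ← val_subset_vonNeumann, hyb, val_subset_vonNeumann]
            omega
        obtain ⟨z, hz, hzv⟩ := h1 c' hc' y hy hyn
        rw [val, ← hyb, ← hcc, ← hzv]
        exact mem_val.2 ⟨z, hz, rfl⟩
    intro x hx
    rw [← val_level] at hx
    obtain ⟨b, -, rfl⟩ := mem_val.1 hx
    rw [val_level, key, val_subset_vonNeumann] at hx
    exact all b hx

end Forest

/-! ### The formulas -/

namespace FOFormula

/-- An assignment extended by a value for the last variable. -/
def extend {n k : ℕ} (s : Fin k → Fin n) (p : Fin n) : Fin (k + 1) → Fin n :=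
  Fin.snoc (α := fun _ => Fin n) s p

@[simp] theorem extend_castSucc {n k : ℕ} (s : Fin k → Fin n) (p : Fin n) (x : Fin k) :
    extend s p x.castSucc = s x :=
  Fin.snoc_castSucc (α := fun _ => Fin n) p s x

@[simp] theorem extend_last {n k : ℕ} (s : Fin k → Fin n) (p : Fin n) :
    extend s p (Fin.last k) = p :=
  Fin.snoc_last (α := fun _ => Fin n) p s

def imp {k : ℕ} (φ ψ : FOFormula k) : FOFormula k := or (neg φ) ψ

section Sat

variable {w : Word} {k : ℕ} {s : Fin k → Fin w.length}

@[simp] theorem sat_eq {x y : Fin k} : Sat w (eq x y) s ↔ s x = s y := Iff.rfl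
@[simp] theorem sat_lt {x y : Fin k} : Sat w (lt x y) s ↔ s x < s y := Iff.rfl
@[simp] theorem sat_letter {a : Brace} {x : Fin k} : Sat w (letter a x) s ↔ w[(s x : ℕ)] = a :=
  Iff.rfl
@[simp] theorem sat_neg {φ : FOFormula k} : Sat w (neg φ) s ↔ ¬ Sat w φ s := Iff.rfl
@[simp] theorem sat_and {φ ψ : FOFormula k} : Sat w (and φ ψ) s ↔ Sat w φ s ∧ Sat w ψ s := Iff.rfl
@[simp] theorem sat_or {φ ψ : FOFormula k} : Sat w (or φ ψ) s ↔ Sat w φ s ∨ Sat w ψ s := Iff.rfl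
@[simp] theorem sat_ex {φ : FOFormula (k + 1)} :
    Sat w (ex φ) s ↔ ∃ p, Sat w φ (extend s p) := Iff.rfl
@[simp] theorem sat_all {φ : FOFormula (k + 1)} :
    Sat w (all φ) s ↔ ∀ p, Sat w φ (extend s p) := Iff.rfl
@[simp] theorem sat_imp {φ ψ : FOFormula k} : Sat w (imp φ ψ) s ↔ (Sat w φ s → Sat w ψ s) := by
  rw [imp, sat_or, sat_neg, imp_iff_not_or]

end Sat

/-- `x` and `y` are the first and the last position of a block of depth less than `d`. -/
def block : ℕ → {k : ℕ} → Fin k → Fin k → FOFormula k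
  -- No depth is less than zero, so this case must be false. In `sameSet`, `prec` and `ordered` the
  -- depth-zero case is never reached and its value is arbitrary.
  | 0, _, x, _ => neg (eq x x)
  | d + 1, k, x, y => and (lt x y) (and (letter Brace.l x) (and (letter Brace.r y) (all (imp
      (and (lt x.castSucc (Fin.last k)) (lt (Fin.last k) y.castSucc))
      (ex (ex (and (lt x.castSucc.castSucc.castSucc (Fin.last (k + 1)).castSucc)
        (and (neg (lt (Fin.last k).castSucc.castSucc (Fin.last (k + 1)).castSucc))
          (and (neg (lt (Fin.last (k + 2)) (Fin.last k).castSucc.castSucc))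
            (and (lt (Fin.last (k + 2)) y.castSucc.castSucc.castSucc)
              (block d (Fin.last (k + 1)).castSucc (Fin.last (k + 2)))))))))))))

/-- `c` is the first position of a child of the block of depth less than `D` that starts at `x`. -/
def child (D : ℕ) {k : ℕ} (x c : Fin k) : FOFormula k :=
  ex (and (block D x.castSucc (Fin.last k)) (and (lt x.castSucc c.castSucc)
    (and (lt c.castSucc (Fin.last k)) (all (imp
      (and (lt x.castSucc.castSucc (Fin.last (k + 1)))
        (lt (Fin.last (k + 1)) c.castSucc.castSucc))
      (all (imp (block D (Fin.last (k + 1)).castSucc (Fin.last (k + 2)))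
        (lt (Fin.last (k + 2)) c.castSucc.castSucc.castSucc))))))))

def exChild (D : ℕ) {k : ℕ} (x : Fin k) (φ : FOFormula (k + 1)) : FOFormula k :=
  ex (and (child D x.castSucc (Fin.last k)) φ)

def allChild (D : ℕ) {k : ℕ} (x : Fin k) (φ : FOFormula (k + 1)) : FOFormula k :=
  all (imp (child D x.castSucc (Fin.last k)) φ)

/-- The blocks of depth less than `d` that start at `x` and `y` represent the same set. -/
def sameSet (D : ℕ) : ℕ → {k : ℕ} → Fin k → Fin k → FOFormula k
  | 0, _, x, _ => eq x x
  -- Quantifying over the pairs $(x,y)$ and $(y,x)$ states both inclusions with one recursive call.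
  -- Two calls would make the size exponential.
  | d + 1, k, x, y => all (all (imp
      (or (and (eq (Fin.last k).castSucc x.castSucc.castSucc)
            (eq (Fin.last (k + 1)) y.castSucc.castSucc))
          (and (eq (Fin.last k).castSucc y.castSucc.castSucc)
            (eq (Fin.last (k + 1)) x.castSucc.castSucc)))
      (allChild D (Fin.last k).castSucc (exChild D (Fin.last (k + 1)).castSucc
        (sameSet D d (Fin.last (k + 2)).castSucc (Fin.last (k + 3)))))))

/-- The sets represented by the blocks of depth less than `d` that start at `x` and `y` are related
by `SetPrec`. -/
def prec (D : ℕ) : ℕ → {k : ℕ} → Fin k → Fin k → FOFormula k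
  | 0, _, x, _ => eq x x
  | d + 1, k, x, y => exChild D y (and
      (allChild D x.castSucc (neg (sameSet D D (Fin.last (k + 1)) (Fin.last k).castSucc)))
      (allChild D x.castSucc (or
        (exChild D y.castSucc.castSucc
          (sameSet D D (Fin.last (k + 1)).castSucc (Fin.last (k + 2))))
        (prec D d (Fin.last (k + 1)) (Fin.last k).castSucc))))

/-- The block of depth less than `d` that starts at `x` is hereditarily ordered. -/
def ordered (D : ℕ) : ℕ → {k : ℕ} → Fin k → FOFormula k
  | 0, _, x => eq x x
  | d + 1, k, x => and
      (allChild D x (allChild D x.castSucc (imp (lt (Fin.last k).castSucc (Fin.last (k + 1)))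
        (prec D D (Fin.last k).castSucc (Fin.last (k + 1))))))
      (allChild D x (ordered D d (Fin.last k)))

/-- The set represented at `z` arises from that at `c` by adjoining the one at `y`. -/
def isInsert (D : ℕ) {k : ℕ} (z y c : Fin k) : FOFormula k :=
  and (exChild D z (sameSet D D (Fin.last k) y.castSucc)) (and
    (allChild D c (exChild D z.castSucc (sameSet D D (Fin.last k).castSucc (Fin.last (k + 1)))))
    (allChild D z (or (sameSet D D (Fin.last k) y.castSucc)
      (exChild D c.castSucc (sameSet D D (Fin.last k).castSucc (Fin.last (k + 1)))))))

def closed (D n : ℕ) {k : ℕ} (x : Fin k) : FOFormula k :=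
  and (exChild D x (allChild D (Fin.last k) (neg (eq (Fin.last (k + 1)) (Fin.last (k + 1))))))
    (allChild D x (allChild D x.castSucc (imp
      -- At the start of a tree, this says that the tree has depth less than `n`.
      (ex (block n (Fin.last (k + 1)).castSucc (Fin.last (k + 2))))
      (exChild D x.castSucc.castSucc
        (isInsert D (Fin.last (k + 2)) (Fin.last (k + 1)).castSucc (Fin.last k).castSucc.castSucc)))))

/-- The block of depth at most `i` that starts at `x` represents the `i`-th level of the cumulative
hierarchy. -/
def isLevel (D : ℕ) : ℕ → {k : ℕ} → Fin k → FOFormula k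
  | 0, _, x => eq x x
  | n + 1, _, x => closed D n x

/-- The sentence that defines the ordered encoding of the `i`-th level. -/
def describeLevel (i : ℕ) : FOSentence :=
  ex (ex (and (all (neg (lt (Fin.last 2) (0 : Fin 3)))) (and (all (neg (lt (1 : Fin 3) (Fin.last 2))))
    (and (block (i + 1) (0 : Fin 2) 1)
      (and (ordered (i + 1) (i + 1) (0 : Fin 2)) (isLevel (i + 1) i (0 : Fin 2)))))))

/-! ### Correctness of the formulas -/

section Semantics

variable {w : Word} {k : ℕ} {s : Fin k → Fin w.length}

theorem sat_block {d : ℕ} {x y : Fin k} : Sat w (block d x y) s ↔ IsBlock w d (s x) (s y) := by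
  induction d generalizing k with
  | zero => simp [block, IsBlock]
  | succ d ih =>
    by_cases hxy : s x < s y
    · rw [isBlock_succ_iff (s y).2 hxy]
      simp only [block, sat_and, sat_lt, sat_letter, sat_all, sat_imp, sat_ex, sat_neg,
        extend_castSucc, extend_last, ih, hxy, true_and, not_lt, Fin.forall_iff, Fin.lt_def,
        Fin.exists_iff]
      refine and_congr_right fun _ => and_congr_right fun _ => ?_
      constructor
      · intro h z h1 h2
        obtain ⟨u, _, v, _, h⟩ := h z (h2.trans (s y).2) ⟨h1, h2⟩
        exact ⟨u, v, h⟩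
      · rintro h z _ ⟨h1, h2⟩
        obtain ⟨u, v, h⟩ := h z h1 h2
        exact ⟨u, by omega, v, h.2.2.2.2.lt_length, h⟩
    · simp only [block, sat_and, sat_lt, hxy, false_and, false_iff]
      exact fun h => hxy h.lt

theorem sat_child {D : ℕ} {x c : Fin k} : Sat w (child D x c) s ↔ IsChild w D (s x) (s c) := by
  simp only [child, sat_and, sat_lt, sat_all, sat_imp, sat_ex, extend_castSucc, extend_last,
    sat_block, Fin.forall_iff, Fin.lt_def, Fin.exists_iff, IsChild]
  constructor
  · rintro ⟨y, _, h1, h2, h3, h4⟩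
    exact ⟨y, h1, h2, h3, fun u v hu hv h => h4 u (hv.trans (s c).2) ⟨hu, hv⟩ v h.lt_length h⟩
  · rintro ⟨y, h1, h2, h3, h4⟩
    exact ⟨y, h1.lt_length, h1, h2, h3, fun u _ hu v _ h => h4 u v hu.1 hu.2 h⟩

section Child

variable {D : ℕ} {x : Fin k} {a : Forest} {φ : FOFormula (k + 1)} {R : Forest → Prop}

/-- This lemma and its dual replace quantifiers over positions by quantifiers over subtrees; the
later correctness proofs apply them connective by connective. -/
theorem sat_exChild (ha : EncAt w (s x) a) (had : a.depth < D)
    (h : ∀ b ∈ a.toList, ∀ p : Fin w.length, EncAt w p b → (Sat w φ (extend s p) ↔ R b)) :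
    Sat w (exChild D x φ) s ↔ ∃ b ∈ a.toList, R b := by
  simp only [exChild, sat_ex, sat_and, sat_child, extend_castSucc, extend_last]
  constructor
  · rintro ⟨p, hp, hφ⟩
    obtain ⟨b, hb, hpb⟩ := ha.exists_of_isChild had hp
    exact ⟨b, hb, (h b hb p hpb).1 hφ⟩
  · rintro ⟨b, hb, hR⟩
    obtain ⟨p, hp, hpb⟩ := ha.exists_isChild had hb
    have hlt : p < w.length := by
      have := hpb.lt_length
      omega
    exact ⟨⟨p, hlt⟩, hp, (h b hb ⟨p, hlt⟩ hpb).2 hR⟩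

theorem sat_allChild (ha : EncAt w (s x) a) (had : a.depth < D)
    (h : ∀ b ∈ a.toList, ∀ p : Fin w.length, EncAt w p b → (Sat w φ (extend s p) ↔ R b)) :
    Sat w (allChild D x φ) s ↔ ∀ b ∈ a.toList, R b := by
  have := sat_exChild (φ := neg φ) (R := fun b => ¬ R b) ha had
    (fun b hb p hp => not_congr (h b hb p hp))
  rw [← not_iff_not]
  simpa [allChild, exChild] using this

end Child

theorem sat_sameSet {D d : ℕ} {x y : Fin k} {a b : Forest} (ha : EncAt w (s x) a)
    (hb : EncAt w (s y) b) (had : a.depth < d) (hbd : b.depth < d) (hd : d ≤ D) :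
    Sat w (sameSet D d x y) s ↔ a.val = b.val := by
  induction d generalizing k a b with
  | zero => exact absurd had (Nat.not_lt_zero _)
  | succ d ih =>
    -- One inclusion for arbitrary positions, to be used in both directions.
    have key : ∀ (p q : Fin w.length) (a b : Forest), EncAt w p a → EncAt w q b →
        a.depth < d + 1 → b.depth < d + 1 →
        (Sat w (allChild D (Fin.last k).castSucc (exChild D (Fin.last (k + 1)).castSucc
          (sameSet D d (Fin.last (k + 2)).castSucc (Fin.last (k + 3))))) (extend (extend s p) q) ↔
          ∀ c ∈ a.toList, ∃ e ∈ b.toList, c.val = e.val) := by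
      intro p q a b ha hb had hbd
      refine sat_allChild (by simpa using ha) (by omega) fun c hc r hr => ?_
      refine sat_exChild (by simpa using hb) (by omega) fun e he t ht => ?_
      exact ih (by simpa using hr) (by simpa using ht) (depth_lt_of_mem' hc had)
        (depth_lt_of_mem' he hbd) (by omega)
    rw [val_eq_iff, ← key (s x) (s y) a b ha hb had hbd, ← key (s y) (s x) b a hb ha hbd had]
    simp only [sameSet, sat_all, sat_imp, sat_or, sat_and, sat_eq, extend_castSucc, extend_last]
    constructor
    · exact fun h => ⟨h _ _ (.inl ⟨rfl, rfl⟩), h _ _ (.inr ⟨rfl, rfl⟩)⟩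
    · rintro ⟨h1, h2⟩ p q (⟨rfl, rfl⟩ | ⟨rfl, rfl⟩)
      · exact h1
      · exact h2

theorem sat_prec {D d : ℕ} {x y : Fin k} {a b : Forest} (ha : EncAt w (s x) a)
    (hb : EncAt w (s y) b) (had : a.depth < d) (hbd : b.depth < d) (hd : d ≤ D) :
    Sat w (prec D d x y) s ↔ SetPrec a.val b.val := by
  induction d generalizing k a b with
  | zero => exact absurd had (Nat.not_lt_zero _)
  | succ d ih =>
    rw [setPrec_val_iff]
    refine sat_exChild hb (by omega) fun z hz p hp => and_congr ?_ ?_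
    · refine sat_allChild (by simpa using ha) (by omega) fun c hc q hq => not_congr ?_
      have h1 := depth_lt_of_mem' hz hbd
      have h2 := depth_lt_of_mem' hc had
      exact sat_sameSet (by simpa using hq) (by simpa using hp) (by omega) (by omega) le_rfl
    · refine sat_allChild (by simpa using ha) (by omega) fun c hc q hq => or_congr ?_ ?_
      · refine sat_exChild (by simpa using hb) (by omega) fun e he t ht => ?_
        have h1 := depth_lt_of_mem' he hbd
        have h2 := depth_lt_of_mem' hc had
        exact sat_sameSet (by simpa using hq) (by simpa using ht) (by omega) (by omega) le_rfl
      · exact ih (by simpa using hq) (by simpa using hp) (depth_lt_of_mem' hc had)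
          (depth_lt_of_mem' hz hbd) (by omega)

theorem sat_ordered {D d : ℕ} {x : Fin k} {a : Forest} (ha : EncAt w (s x) a)
    (had : a.depth < d) (hd : d ≤ D) : Sat w (ordered D d x) s ↔ a.Ordered := by
  induction d generalizing k a with
  | zero => exact absurd had (Nat.not_lt_zero _)
  | succ d ih =>
    rw [ordered_iff]
    refine and_congr ?_ (sat_allChild ha (by omega) fun b hb p hp =>
      ih (by simpa using hp) (depth_lt_of_mem' hb had) (by omega))
    rw [ha.pairwise_iff (d := D) (by omega)]
    simp only [allChild, sat_all, sat_imp, sat_child, sat_lt, extend_castSucc, extend_last]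
    have key : ∀ (p q : Fin w.length) (b c : Forest), b ∈ a.toList → c ∈ a.toList →
        EncAt w p b → EncAt w q c →
        (Sat w (prec D D (Fin.last k).castSucc (Fin.last (k + 1))) (extend (extend s p) q) ↔
          SetPrec b.val c.val) := by
      intro p q b c hb hc hp hq
      have h1 := depth_lt_of_mem' hb had
      have h2 := depth_lt_of_mem' hc had
      exact sat_prec (by simpa using hp) (by simpa using hq) (by omega) (by omega) le_rfl
    constructor
    · intro h p b q c hp hq hlt hb hc
      have hb' := hb.lt_length
      have hc' := hc.lt_length
      obtain ⟨e, he, hpe⟩ := ha.exists_of_isChild (by omega) hp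
      obtain ⟨f, hf, hqf⟩ := ha.exists_of_isChild (by omega) hq
      obtain rfl := hb.unique hpe
      obtain rfl := hc.unique hqf
      exact (key ⟨p, by omega⟩ ⟨q, by omega⟩ _ _ he hf hb hc).1
        (h ⟨p, by omega⟩ hp ⟨q, by omega⟩ hq hlt)
    · intro h p hp q hq hlt
      obtain ⟨b, hb, hpb⟩ := ha.exists_of_isChild (by omega) hp
      obtain ⟨c, hc, hqc⟩ := ha.exists_of_isChild (by omega) hq
      exact (key p q b c hb hc hpb hqc).2 (h p b q c hp hq hlt hpb hqc)

theorem sat_isInsert {D : ℕ} {z y c : Fin k} {a b e : Forest} (ha : EncAt w (s z) a)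
    (hb : EncAt w (s y) b) (he : EncAt w (s c) e) (had : a.depth < D) (hbd : b.depth < D)
    (hed : e.depth < D) : Sat w (isInsert D z y c) s ↔ a.val = insert b.val e.val := by
  rw [val_eq_insert_iff]
  refine and_congr ?_ (and_congr ?_ ?_)
  · refine sat_exChild ha had fun f hf p hp => ?_
    exact sat_sameSet (by simpa using hp) (by simpa using hb) (depth_lt_of_mem hf had) hbd le_rfl
  · refine sat_allChild he hed fun f hf p hp => ?_
    refine sat_exChild (by simpa using ha) had fun g hg q hq => ?_
    exact sat_sameSet (by simpa using hp) (by simpa using hq) (depth_lt_of_mem hf hed)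
      (depth_lt_of_mem hg had) le_rfl
  · refine sat_allChild ha had fun f hf p hp => or_congr ?_ ?_
    · exact sat_sameSet (by simpa using hp) (by simpa using hb) (depth_lt_of_mem hf had) hbd le_rfl
    · refine sat_exChild (by simpa using he) hed fun g hg q hq => ?_
      exact sat_sameSet (by simpa using hp) (by simpa using hq) (depth_lt_of_mem hf had)
        (depth_lt_of_mem hg hed) le_rfl

theorem sat_closed {D n : ℕ} {x : Fin k} {a : Forest} (ha : EncAt w (s x) a) (had : a.depth < D) :
    Sat w (closed D n x) s ↔ a.Closed n := by
  refine and_congr ?_ ?_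
  · refine sat_exChild ha had fun c hc p hp => ?_
    exact sat_allChild (by simpa using hp) (depth_lt_of_mem hc had) fun e _ q _ => by simp
  · refine sat_allChild ha had fun c hc p hp => ?_
    refine sat_allChild (by simpa using ha) had fun y hy q hq => ?_
    rw [sat_imp]
    refine imp_congr ?_ ?_
    · simp only [sat_ex, sat_block, extend_castSucc, extend_last, hq.isBlock_iff]
      exact ⟨fun ⟨_, h, _⟩ => h, fun h => ⟨⟨_, hq.lt_length⟩, h, rfl⟩⟩
    · refine sat_exChild (by simpa using ha) had fun z hz r hr => ?_
      exact sat_isInsert (by simpa using hr) (by simpa using hq) (by simpa using hp)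
        (depth_lt_of_mem hz had) (depth_lt_of_mem hy had) (depth_lt_of_mem hc had)

/-- The bound `hn` gives the inclusion in $V_n$. For $n = 0$ it already forces the empty set, so the
trivially true formula suffices there. -/
theorem sat_isLevel {D n : ℕ} {x : Fin k} {a : Forest} (ha : EncAt w (s x) a) (had : a.depth < D)
    (hn : a.depth ≤ n) :
    Sat w (isLevel D n x) s ↔ a.val = ZFSet.vonNeumann (n : Ordinal.{0}) := by
  cases n with
  | zero =>
    have h0 := val_subset_vonNeumann.2 hn
    rw [Nat.cast_zero, ZFSet.vonNeumann_zero] at *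
    simp only [isLevel, sat_eq, true_iff]
    exact subset_antisymm h0 (ZFSet.empty_subset _)
  | succ n => rw [val_eq_vonNeumann_iff hn, isLevel, sat_closed ha had]

end Semantics

theorem models_describeLevel_iff (i : ℕ) (w : Word) :
    Models w (describeLevel i) ↔ w = (level i).enc := by
  have h0 : ∀ p q : Fin w.length, extend (extend Fin.elim0 p) q (0 : Fin 2) = p := fun p q =>
    (extend_castSucc (extend Fin.elim0 p) q (Fin.last 0)).trans (extend_last _ _)
  have h1 : ∀ p q : Fin w.length, extend (extend Fin.elim0 p) q (1 : Fin 2) = q := fun p q =>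
    extend_last _ _
  have h0' : ∀ p q r : Fin w.length,
      extend (extend (extend Fin.elim0 p) q) r (0 : Fin 3) = p := fun p q r =>
    (extend_castSucc (extend (extend Fin.elim0 p) q) r (0 : Fin 2)).trans (h0 p q)
  have h1' : ∀ p q r : Fin w.length,
      extend (extend (extend Fin.elim0 p) q) r (1 : Fin 3) = q := fun p q r =>
    (extend_castSucc (extend (extend Fin.elim0 p) q) r (1 : Fin 2)).trans (h1 p q)
  simp only [Models, describeLevel, sat_ex, sat_and, sat_all, sat_neg, sat_lt, sat_block,
    extend_last, h0, h1, h0', h1', not_lt]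
  constructor
  · rintro ⟨p, q, hp, hq, ⟨a, had, ha, hpq⟩, ho, hl⟩
    rw [sat_ordered (a := a) (by rwa [h0]) had le_rfl] at ho
    rw [sat_isLevel (a := a) (by rwa [h0]) had (Nat.lt_succ_iff.1 had)] at hl
    have hw : 0 < w.length := (Nat.zero_le _).trans_lt p.2
    have hp0 : (p : ℕ) = 0 := Nat.le_zero.1 (hp ⟨0, hw⟩)
    have hqw : w.length - 1 ≤ (q : ℕ) := hq ⟨w.length - 1, by omega⟩
    obtain ⟨v, hv⟩ := ha
    rw [hp0, List.drop_zero] at hv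
    have hlen := congrArg List.length hv
    simp only [List.length_cons, List.length_append] at hlen
    -- The block starts at the first and ends at the last position, so nothing follows it.
    obtain rfl : v = [] := List.eq_nil_of_length_eq_zero (by omega)
    rw [hv, ← eq_level_iff.1 ⟨ho, hl⟩, enc]
  · rintro hw
    obtain ⟨ho, hl⟩ := eq_level_iff.2 (rfl : level i = level i)
    have ha : EncAt w 0 (level i) := ⟨[], hw⟩
    have had : (level i).depth ≤ i := val_subset_vonNeumann.1 hl.le
    have hlen : w.length = (level i).code.length + 2 := by simp [hw, enc]
    have hpos : 0 < w.length := by omega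
    refine ⟨⟨0, hpos⟩, ⟨(level i).code.length + 1, by omega⟩, fun z => Nat.zero_le _, fun z => ?_,
      ⟨level i, by omega, ha, by simp⟩, ?_, ?_⟩
    · have := z.2
      simp only [Fin.le_def]
      omega
    · exact (sat_ordered (by rwa [h0]) (by omega) le_rfl).2 ho
    · exact (sat_isLevel (by rwa [h0]) (by omega) had).2 hl

theorem defines_describeLevel (i : ℕ) : Defines (describeLevel i) (level i).enc :=
  ⟨by simp [enc], (models_describeLevel_iff i _).2 rfl,
    fun v _ hv h => hv ((models_describeLevel_iff i v).1 h)⟩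

/-! ### Sizes of the formulas -/

section Size

variable {k D : ℕ}

theorem size_block_le (d : ℕ) (x y : Fin k) : (block d x y).size ≤ 30 * (d + 1) := by
  induction d generalizing k with
  | zero => simp [block, size]
  | succ d ih =>
    have := ih (Fin.last (k + 1)).castSucc (Fin.last (k + 2))
    simp only [block, size, imp]
    omega

theorem size_child_le (x c : Fin k) : (child D x c).size ≤ 90 * (D + 1) := by
  have h1 := size_block_le D x.castSucc (Fin.last k)
  have h2 := size_block_le D (Fin.last (k + 1)).castSucc (Fin.last (k + 2))
  simp only [child, size, imp]
  omega

theorem size_exChild_le (x : Fin k) (φ : FOFormula (k + 1)) :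
    (exChild D x φ).size ≤ φ.size + 100 * (D + 1) := by
  have := size_child_le (D := D) x.castSucc (Fin.last k)
  simp only [exChild, size]
  omega

theorem size_allChild_le (x : Fin k) (φ : FOFormula (k + 1)) :
    (allChild D x φ).size ≤ φ.size + 100 * (D + 1) := by
  have := size_child_le (D := D) x.castSucc (Fin.last k)
  simp only [allChild, size, imp]
  omega

/-- Each step of the recursion adds two child quantifiers, each of size linear in `D`. -/
theorem size_sameSet_le (d : ℕ) (x y : Fin k) :
    (sameSet D d x y).size ≤ 300 * (D + 1) * (d + 1) := by
  induction d generalizing k with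
  | zero => simp only [sameSet, size]; omega
  | succ d ih =>
    have h := ih (Fin.last (k + 2)).castSucc (Fin.last (k + 3))
    have h1 := size_exChild_le (D := D) (Fin.last (k + 1)).castSucc
      (sameSet D d (Fin.last (k + 2)).castSucc (Fin.last (k + 3)))
    have h2 := size_allChild_le (D := D) (Fin.last k).castSucc
      (exChild D (Fin.last (k + 1)).castSucc
        (sameSet D d (Fin.last (k + 2)).castSucc (Fin.last (k + 3))))
    simp only [sameSet, size, imp]
    -- After this split the products are atoms and the estimate is linear.
    rw [mul_add_one _ (d + 1)]
    omega

theorem size_sameSet_self_le (x y : Fin k) : (sameSet D D x y).size ≤ 300 * (D + 1) ^ 2 :=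
  (size_sameSet_le D x y).trans_eq (by ring)

/-- The cost of a step is dominated by two copies of `sameSet D D`, which are quadratic. -/
theorem size_prec_le (d : ℕ) (x y : Fin k) :
    (prec D d x y).size ≤ 1500 * (D + 1) ^ 2 * (d + 1) := by
  have hD : D + 1 ≤ (D + 1) ^ 2 := Nat.le_self_pow two_ne_zero _
  induction d generalizing k with
  | zero => simp only [prec, size]; omega
  | succ d ih =>
    simp only [prec]
    refine (size_exChild_le _ _).trans ?_
    simp only [size]
    have h1 := size_allChild_le (D := D) x.castSucc
      (neg (sameSet D D (Fin.last (k + 1)) (Fin.last k).castSucc))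
    have h2 := size_allChild_le (D := D) x.castSucc (or
        (exChild D y.castSucc.castSucc
          (sameSet D D (Fin.last (k + 1)).castSucc (Fin.last (k + 2))))
        (prec D d (Fin.last (k + 1)) (Fin.last k).castSucc))
    have h3 := size_exChild_le (D := D) y.castSucc.castSucc
      (sameSet D D (Fin.last (k + 1)).castSucc (Fin.last (k + 2)))
    have h4 := size_sameSet_self_le (D := D) (Fin.last (k + 1)) (Fin.last k).castSucc
    have h5 := size_sameSet_self_le (D := D) (Fin.last (k + 1)).castSucc (Fin.last (k + 2))
    have h6 := ih (Fin.last (k + 1)) (Fin.last k).castSucc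
    simp only [size] at h1 h2
    rw [mul_add_one _ (d + 1)]
    omega

/-- The cost of a step is dominated by the cubic `prec D D`; this is what makes the whole sentence
quartic. -/
theorem size_ordered_le (d : ℕ) (x : Fin k) :
    (ordered D d x).size ≤ 2000 * (D + 1) ^ 3 * (d + 1) := by
  have hD : D + 1 ≤ (D + 1) ^ 3 := Nat.le_self_pow three_ne_zero _
  induction d generalizing k with
  | zero => simp only [ordered, size]; omega
  | succ d ih =>
    have h0 : (prec D D (Fin.last k).castSucc (Fin.last (k + 1))).size ≤ 1500 * (D + 1) ^ 3 :=
      (size_prec_le D _ _).trans_eq (by ring)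
    have h1 := size_allChild_le (D := D) x (allChild D x.castSucc
      (imp (lt (Fin.last k).castSucc (Fin.last (k + 1)))
        (prec D D (Fin.last k).castSucc (Fin.last (k + 1)))))
    have h2 := size_allChild_le (D := D) x.castSucc
      (imp (lt (Fin.last k).castSucc (Fin.last (k + 1)))
        (prec D D (Fin.last k).castSucc (Fin.last (k + 1))))
    have h3 := size_allChild_le (D := D) x (ordered D d (Fin.last k))
    have h4 := ih (Fin.last k)
    simp only [size, imp] at h2
    simp only [ordered, size]
    rw [mul_add_one _ (d + 1)]
    simp only [imp] at *
    omega

theorem size_isInsert_le (z y c : Fin k) : (isInsert D z y c).size ≤ 2000 * (D + 1) ^ 2 := by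
  have hD : D + 1 ≤ (D + 1) ^ 2 := Nat.le_self_pow two_ne_zero _
  have h1 := size_sameSet_self_le (D := D) (Fin.last k) y.castSucc
  have h2 := size_sameSet_self_le (D := D) (Fin.last k).castSucc (Fin.last (k + 1))
  have h3 := size_exChild_le (D := D) z (sameSet D D (Fin.last k) y.castSucc)
  have h4 := size_exChild_le (D := D) z.castSucc
    (sameSet D D (Fin.last k).castSucc (Fin.last (k + 1)))
  have h5 := size_exChild_le (D := D) c.castSucc
    (sameSet D D (Fin.last k).castSucc (Fin.last (k + 1)))
  have h6 := size_allChild_le (D := D) c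
    (exChild D z.castSucc (sameSet D D (Fin.last k).castSucc (Fin.last (k + 1))))
  have h7 := size_allChild_le (D := D) z (or (sameSet D D (Fin.last k) y.castSucc)
      (exChild D c.castSucc (sameSet D D (Fin.last k).castSucc (Fin.last (k + 1)))))
  simp only [size] at h7
  simp only [isInsert, size]
  omega

theorem size_closed_le {n : ℕ} (hn : n ≤ D) (x : Fin k) :
    (closed D n x).size ≤ 3000 * (D + 1) ^ 2 := by
  have hD : D + 1 ≤ (D + 1) ^ 2 := Nat.le_self_pow two_ne_zero _
  have h1 := size_exChild_le (D := D) x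
    (allChild D (Fin.last k) (neg (eq (Fin.last (k + 1)) (Fin.last (k + 1)))))
  have h2 := size_allChild_le (D := D) (Fin.last k)
    (neg (eq (Fin.last (k + 1)) (Fin.last (k + 1))))
  have h3 := size_isInsert_le (D := D) (Fin.last (k + 2)) (Fin.last (k + 1)).castSucc
    (Fin.last k).castSucc.castSucc
  have h4 := size_exChild_le (D := D) x.castSucc.castSucc (isInsert D (Fin.last (k + 2))
    (Fin.last (k + 1)).castSucc (Fin.last k).castSucc.castSucc)
  have h5 := size_block_le n (Fin.last (k + 1)).castSucc (Fin.last (k + 2))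
  have h6 := size_allChild_le (D := D) x.castSucc
    (imp (ex (block n (Fin.last (k + 1)).castSucc (Fin.last (k + 2))))
      (exChild D x.castSucc.castSucc (isInsert D (Fin.last (k + 2))
        (Fin.last (k + 1)).castSucc (Fin.last k).castSucc.castSucc)))
  have h7 := size_allChild_le (D := D) x (allChild D x.castSucc
    (imp (ex (block n (Fin.last (k + 1)).castSucc (Fin.last (k + 2))))
      (exChild D x.castSucc.castSucc (isInsert D (Fin.last (k + 2))
        (Fin.last (k + 1)).castSucc (Fin.last k).castSucc.castSucc))))
  simp only [size, imp] at h2 h6 h7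
  simp only [closed, size, imp]
  omega

theorem size_isLevel_le {n : ℕ} (hn : n ≤ D) (x : Fin k) :
    (isLevel D n x).size ≤ 3000 * (D + 1) ^ 2 := by
  cases n with
  | zero =>
    have : 0 < (D + 1) ^ 2 := by positivity
    simp only [isLevel, size]
    omega
  | succ n => exact size_closed_le (by omega) x

theorem size_describeLevel_le (i : ℕ) : (describeLevel i).size ≤ 6000 * (i + 2) ^ 4 := by
  have h1 := size_block_le (i + 1) (0 : Fin 2) 1
  have h2 := (size_ordered_le (D := i + 1) (i + 1) (0 : Fin 2)).trans_eq
    (show _ = 2000 * (i + 2) ^ 4 by ring)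
  have h3 := size_isLevel_le (D := i + 1) (n := i) (by omega) (0 : Fin 2)
  have h4 : i + 2 ≤ (i + 2) ^ 4 := Nat.le_self_pow four_ne_zero _
  have h5 : (i + 1 + 1) ^ 2 ≤ (i + 2) ^ 4 := Nat.pow_le_pow_right (by omega) (by omega)
  simp only [describeLevel, size]
  omega

end Size

end FOFormula

/-! ### Finiteness and existence of the maxima -/

namespace FOFormula

theorem size_pos {k : ℕ} (φ : FOFormula k) : 0 < φ.size := by
  cases φ <;> simp [size]

instance : Finite Brace :=
  Finite.of_surjective (fun b : Bool => if b then Brace.l else Brace.r) fun a => by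
    cases a
    · exact ⟨true, rfl⟩
    · exact ⟨false, rfl⟩

/-- Bound variables carry no names, so finitely many formulas of each size exist for a given `k`.
The induction varies `k` because quantifiers raise it. -/
theorem finite_size_le (n k : ℕ) : {φ : FOFormula k | φ.size ≤ n}.Finite := by
  induction n generalizing k with
  | zero =>
    refine Set.finite_empty.subset fun φ h => ?_
    have h' : φ.size ≤ 0 := h
    have := φ.size_pos
    omega
  | succ n ih =>
    have hpair := (ih k).prod (ih k)
    refine ((Set.finite_range fun p : Fin k × Fin k => eq p.1 p.2).union
      ((Set.finite_range fun p : Fin k × Fin k => lt p.1 p.2).union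
      ((Set.finite_range fun p : Brace × Fin k => letter p.1 p.2).union
      (((ih k).image neg).union ((hpair.image fun p => and p.1 p.2).union
      ((hpair.image fun p => or p.1 p.2).union (((ih (k + 1)).image ex).union
      ((ih (k + 1)).image all)))))))).subset fun φ h => ?_
    have h' : φ.size ≤ n + 1 := h
    cases φ with
    | eq x y => exact .inl ⟨(x, y), rfl⟩
    | lt x y => exact .inr (.inl ⟨(x, y), rfl⟩)
    | letter a x => exact .inr (.inr (.inl ⟨(a, x), rfl⟩))
    | neg φ => exact .inr (.inr (.inr (.inl ⟨φ, Nat.le_of_succ_le_succ h', rfl⟩)))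
    | and φ ψ =>
      simp only [size] at h'
      exact .inr (.inr (.inr (.inr (.inl ⟨(φ, ψ), ⟨show φ.size ≤ n by omega,
        show ψ.size ≤ n by omega⟩, rfl⟩))))
    | or φ ψ =>
      simp only [size] at h'
      exact .inr (.inr (.inr (.inr (.inr (.inl ⟨(φ, ψ), ⟨show φ.size ≤ n by omega,
        show ψ.size ≤ n by omega⟩, rfl⟩)))))
    | ex φ => exact .inr (.inr (.inr (.inr (.inr (.inr (.inl
        ⟨φ, Nat.le_of_succ_le_succ h', rfl⟩))))))
    | all φ => exact .inr (.inr (.inr (.inr (.inr (.inr (.inr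
        ⟨φ, Nat.le_of_succ_le_succ h', rfl⟩))))))

end FOFormula

/-- Each of the finitely many sentences defines at most one word. -/
theorem finite_definableLengths (n : ℕ) : (definableLengths (FOsz n)).Finite := by
  refine (((FOFormula.finite_size_le n 0).biUnion
    (t := fun φ => {w : Word | Defines φ w}) fun φ _ => ?_).image List.length).subset ?_
  · refine Set.Subsingleton.finite fun v hv w hw => ?_
    by_contra hne
    exact hw.2.2 v hv.1 hne hv.2.1
  · rintro m ⟨w, ⟨φ, hφ, hw⟩, rfl⟩
    exact ⟨w, Set.mem_biUnion hφ hw, rfl⟩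

theorem finite_maxModelLengths (n : ℕ) : (maxModelLengths (FOsz n)).Finite :=
  (FOFormula.finite_size_le n 0).image maxModelLength

theorem Defines.maxModelLength_eq {φ : FOSentence} {w : Word} (h : Defines φ w) :
    maxModelLength φ = w.length := by
  have : modelLengths φ = {w.length} := by
    ext m
    constructor
    · rintro ⟨v, hv, hvφ, rfl⟩
      by_contra hne
      exact h.2.2 v hv (fun e => hne (e ▸ rfl)) hvφ
    · rintro rfl
      exact ⟨w, h.1, h.2.1, rfl⟩
  rw [maxModelLength, this, if_pos bddAbove_singleton, csSup_singleton]

theorem isGreatest_definabilityNumber {n : ℕ} {w : Word} {φ : FOSentence} (hφ : φ.size ≤ n)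
    (h : Defines φ w) :
    IsGreatest (definableLengths (FOsz n)) (definabilityNumber (FOsz n)) ∧
      w.length ≤ definabilityNumber (FOsz n) := by
  have hmem : w.length ∈ definableLengths (FOsz n) := ⟨w, ⟨φ, hφ, h⟩, rfl⟩
  have hbdd := (finite_definableLengths n).bddAbove
  exact ⟨⟨Nat.sSup_mem ⟨_, hmem⟩ hbdd, fun m hm => le_csSup hbdd hm⟩, le_csSup hbdd hmem⟩

theorem isGreatest_hanfNumber {n : ℕ} {w : Word} {φ : FOSentence} (hφ : φ.size ≤ n)
    (h : Defines φ w) :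
    IsGreatest (maxModelLengths (FOsz n)) (hanfNumber (FOsz n)) ∧
      w.length ≤ hanfNumber (FOsz n) := by
  have hmem : w.length ∈ maxModelLengths (FOsz n) := ⟨φ, hφ, h.maxModelLength_eq⟩
  have hbdd := (finite_maxModelLengths n).bddAbove
  exact ⟨⟨Nat.sSup_mem ⟨_, hmem⟩ hbdd, fun m hm => le_csSup hbdd hm⟩, le_csSup hbdd hmem⟩

/-! ### The lower bounds along $n = c\,i^5$ -/

theorem twr_root_mul_pow {c : ℕ} (hc : 0 < c) (i : ℕ) :
    twr ((((c * i ^ 5 : ℕ) : ℝ) / (c : ℝ)) ^ ((1 : ℝ) / 5)) = tower i := by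
  have hc' : (c : ℝ) ≠ 0 := by positivity
  have : (((c * i ^ 5 : ℕ) : ℝ) / (c : ℝ)) ^ ((1 : ℝ) / 5) = (i : ℝ) := by
    rw [Nat.cast_mul, mul_div_cancel_left₀ _ hc', Nat.cast_pow]
    have := Real.pow_rpow_inv_natCast (x := (i : ℝ)) (n := 5) (by positivity) (by norm_num)
    simpa using this
  rw [twr, this, Nat.ceil_natCast]

theorem infinite_setOf_of_mul_pow {c : ℕ} (hc : 0 < c) {P : ℕ → Prop}
    (h : ∀ i, 1 ≤ i → P (c * i ^ 5)) : {n | P n}.Infinite := by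
  refine Set.infinite_of_forall_exists_gt fun a => ⟨c * (a + 1) ^ 5, h _ (by omega), ?_⟩
  calc a < a + 1 := a.lt_succ_self
    _ ≤ (a + 1) ^ 5 := Nat.le_self_pow (by norm_num) _
    _ ≤ c * (a + 1) ^ 5 := Nat.le_mul_of_pos_left _ hc

/-- One constant serves $j = i$, for the third claim, and $j = i + 1$, for the first two; $j + 2 \le
i + 3 \le 4i$ gives $6000 \cdot 4^4 = 1536000$. -/
theorem FOFormula.size_describeLevel_le_mul_pow {i j : ℕ} (hi : 1 ≤ i) (hj : j ≤ i + 1) :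
    (describeLevel j).size ≤ 1600000 * i ^ 5 := by
  calc (describeLevel j).size ≤ 6000 * (j + 2) ^ 4 := size_describeLevel_le _
    _ ≤ 6000 * (4 * i) ^ 4 := by gcongr; omega
    _ = 1536000 * i ^ 4 := by ring
    _ ≤ 1600000 * i ^ 5 := by
      gcongr
      · norm_num
      · norm_num

theorem theorem3 :
    -- the lower bound for the definability number, which exists as a maximum
    (∃ c : ℕ, 0 < c ∧
      {n : ℕ | IsGreatest (definableLengths (FOsz n)) (definabilityNumber (FOsz n)) ∧
        twr (((n : ℝ) / (c : ℝ)) ^ ((1 : ℝ) / 5)) ≤ definabilityNumber (FOsz n)}.Infinite) ∧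
    -- the same lower bound for the Hanf number, which exists as a maximum
    (∃ c : ℕ, 0 < c ∧
      {n : ℕ | IsGreatest (maxModelLengths (FOsz n)) (hanfNumber (FOsz n)) ∧
        twr (((n : ℝ) / (c : ℝ)) ^ ((1 : ℝ) / 5)) ≤ hanfNumber (FOsz n)}.Infinite) ∧
    -- sentences of size `O(i ^ 5)` that define the ordered encoding of the `i`-th level `V_ i` of
    -- the cumulative hierarchy, and the length of that word
    (∃ (c : ℕ) (ψ : ℕ → FOSentence) (w : ℕ → Word),
      (∀ i : ℕ, 1 ≤ i → (ψ i).size ≤ c * i ^ 5) ∧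
      (∀ i : ℕ, ∀ v : Word, OrderedEncoding v (ZFSet.vonNeumann (i : Ordinal.{0})) ↔ v = w i) ∧
      (∀ i : ℕ, Defines (ψ i) (w i)) ∧
      (∀ i : ℕ, tower i ≤ (w (i + 1)).length)) := by
  have hc : 0 < 1600000 := by norm_num
  refine ⟨⟨1600000, hc, infinite_setOf_of_mul_pow hc fun i hi => ?_⟩,
    ⟨1600000, hc, infinite_setOf_of_mul_pow hc fun i hi => ?_⟩,
    1600000, FOFormula.describeLevel, fun i => (level i).enc,
    fun i hi => FOFormula.size_describeLevel_le_mul_pow hi i.le_succ, orderedEncoding_vonNeumann_iff,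
    FOFormula.defines_describeLevel, tower_le_length_enc⟩
  · rw [twr_root_mul_pow hc]
    -- The level is $i + 1$, since the encoding of $V_{i+1}$ is the one known to have length at
    -- least $\mathrm{tower}(i)$.
    obtain ⟨h1, h2⟩ := isGreatest_definabilityNumber (FOFormula.size_describeLevel_le_mul_pow hi le_rfl)
      (FOFormula.defines_describeLevel (i + 1))
    exact ⟨h1, (tower_le_length_enc i).trans h2⟩
  · rw [twr_root_mul_pow hc]
    obtain ⟨h1, h2⟩ := isGreatest_hanfNumber (FOFormula.size_describeLevel_le_mul_pow hi le_rfl)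
      (FOFormula.defines_describeLevel (i + 1))
    exact ⟨h1, (tower_le_length_enc i).trans h2⟩
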